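/- Let $\mathcal X,\mathcal Y$ be finite sets and let $W$ be a discrete memoryless channel from $\mathcal X$ to $\mathcal Y$, i.e. a stochastic matrix $W(y|x)$. Call $W$ *singular* if $W(y|x)=W(y|z)$ whenever $W(y|x)W(y|z)>0$. Call $W$ *symmetric* if $\mathcal Y$ can be partitioned into subsets such that, in the submatrix of $W$ formed by the columns of each subset, every row is a permutation of every other row and every column is a permutation of every other column; otherwise $W$ is *asymmetric*. For a distribution $P$ on $\mathcal X$ let $q_P(y)=\sum_x P(x)W(y|x)$, $I(P;W)=\sum_{x,y}P(x)W(y|x)\ln\frac{W(y|x)}{q_P(y)}$, $C(W)=\max_P I(P;W)$, and $$V(P,W)=\sum_{x,y}P(x)W(y|x)\Big[\ln\tfrac{W(y|x)}{q_P(y)}-\sum_b W(b|x)\ln\tfrac{W(b|x)}{q_P(b)}\Big]^2 .$$ For $\epsilon\in(0,1)$ let $V_\epsilon(W)$ be the minimum (if $\epsilon<1/2$), respectively the maximum (if $\epsilon\ge 1/2$), of $V(Q,W)$ over all $Q$ with $I(Q;W)=C(W)$. For $n\in\mathbb Z^+$ and $R\in\mathbb R$, an $(n,R)$ code consists of an encoder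 $f:\{1,\dots,\lceil e^{nR}\rceil\}\to\mathcal X^n$ and a decoder $\varphi:\mathcal Y^n\to\{1,\dots,\lceil e^{nR}\rceil\}$; it is a *constant composition* code if all codewords have the same empirical distribution. Let $\bar{\mathrm P}_{\mathrm{e,c}}(n,R)$ be the minimum, over all $(n,R)$ constant composition codes, of the average error probability over $n$ uses of $W$ with equiprobable messages, and let $$M^*_{\mathrm c}(n,\epsilon)=\max\{\lceil e^{nR}\rceil : \bar{\mathrm P}_{\mathrm{e,c}}(n,R)\le\epsilon\}.$$ Let $\Phi$ be the distribution function of the standard normal law. Let $W$ be singular and asymmetric. (i) If $\epsilon\in(0,1/2)$, then there is a constant $\tilde K(\epsilon,W)>0$ such that, for all $n\in\mathbb Z^+$, $$\ln M^*_{\mathrm c}(n,\epsilon)\le nC(W)+\sqrt{nV_\epsilon(W)}\,\Phi^{-1}(\epsilon)+\tilde K(\epsilon,W).$$ (ii) If $\epsilon\in(1/2,1)$ and $V_\epsilon(W)>0$, then there is a constant $\tilde K'(\epsilon,W)>0$ such that, for all $n\in\mathbb Z^+$, $$\ln M^*_{\mathrm c}(n,\epsilon)\le nC(W)+\sqrt{nV_\epsilon(W)}\,\Phi^{-1}(\epsilon)+\tilde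 K'(\epsilon,W).$$ -/

import Mathlib

noncomputable section

namespace NormalApprox

/-- `W : X → Y → ℝ` is a stochastic matrix (a discrete memoryless channel): `W x y` is the
probability of the output letter `y` given the input letter `x`. -/
def IsChannel {X Y : Type*} [Fintype Y] (W : X → Y → ℝ) : Prop :=
  ∀ x, W x ∈ stdSimplex ℝ Y

/-- The outputs can be partitioned (into the classes of a setoid) such that, in the submatrix of
each class, every row is a permutation of every other row and every column is a permutation of
every other column. -/
def IsSymmetricChannel {X Y : Type*} (W : X → Y → ℝ) : Prop :=
  ∃ s : Setoid Y, ∀ B ∈ s.classes,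
    (∀ x x' : X, ∃ σ : Equiv.Perm B, ∀ y : B, W x' y = W x (σ y)) ∧
    (∀ y ∈ B, ∀ y' ∈ B, ∃ τ : Equiv.Perm X, ∀ x : X, W x y' = W (τ x) y)

/-- Within every column, any two positive entries are equal. -/
def IsSingularChannel {X Y : Type*} (W : X → Y → ℝ) : Prop :=
  ∀ (x : X) (y : Y) (z : X), 0 < W x y * W z y → W x y = W z y

/-- The output distribution `q_P` induced by the input distribution `P`. -/
def outputDist {X Y : Type*} [Fintype X] (W : X → Y → ℝ) (P : X → ℝ) (y : Y) : ℝ :=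
  ∑ x, P x * W x y

/-- The mutual information `I(P; W)`, in nats. -/
def mutualInfo {X Y : Type*} [Fintype X] [Fintype Y] (W : X → Y → ℝ) (P : X → ℝ) : ℝ :=
  ∑ x, ∑ y, P x * W x y * Real.log (W x y / outputDist W P y)

/-- The capacity `C(W) = max_P I(P; W)` (the mutual information is continuous in `P` and the
simplex is compact). -/
def capacity {X Y : Type*} [Fintype X] [Fintype Y] (W : X → Y → ℝ) : ℝ :=
  sSup (mutualInfo W '' stdSimplex ℝ X)

/-- The capacity-achieving input distributions. -/
def capacityAchieving {X Y : Type*} [Fintype X] [Fintype Y] (W : X → Y → ℝ) : Set (X → ℝ) :=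
  {P | P ∈ stdSimplex ℝ X ∧ mutualInfo W P = capacity W}

/-- The dispersion `V(P, W)`. -/
def dispersion {X Y : Type*} [Fintype X] [Fintype Y] (W : X → Y → ℝ) (P : X → ℝ) : ℝ :=
  ∑ x, ∑ y, P x * W x y *
    (Real.log (W x y / outputDist W P y)
      - ∑ b, W x b * Real.log (W x b / outputDist W P b)) ^ 2

/-- The `ε`-dispersion: the minimum of the dispersion over the capacity-achieving input
distributions when `ε < 1/2`, the maximum when `ε ≥ 1/2` (the dispersion is continuous and
the set of capacity-achieving input distributions is compact and nonempty). -/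
def epsDispersion {X Y : Type*} [Fintype X] [Fintype Y] (W : X → Y → ℝ) (ε : ℝ) : ℝ :=
  if ε < 1 / 2 then sInf (dispersion W '' capacityAchieving W)
  else sSup (dispersion W '' capacityAchieving W)

/-- The inverse `Φ⁻¹` of the distribution function of the standard normal law. -/
def stdNormalQuantile (p : ℝ) : ℝ :=
  sInf {z : ℝ | p ≤ ProbabilityTheory.cdf (ProbabilityTheory.gaussianReal 0 1) z}

/-- The average error probability of the code with encoder `f` and decoder `φ`, over `n` uses of
the memoryless channel `W`, for `M` equiprobable messages. -/
def avgError {X Y : Type*} [Fintype Y] {n M : ℕ} (W : X → Y → ℝ)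
    (f : Fin M → Fin n → X) (φ : (Fin n → Y) → Fin M) : ℝ :=
  (1 / (M : ℝ)) * ∑ m, ∑ y : Fin n → Y with φ y ≠ m, ∏ i, W (f m i) (y i)

/-- The empirical distribution (type) of a sequence. -/
def empiricalDist {X : Type*} [DecidableEq X] {n : ℕ} (x : Fin n → X) (a : X) : ℝ :=
  ((Finset.univ.filter fun i => x i = a).card : ℝ) / n

/-- All codewords have the same empirical distribution. -/
def IsConstComposition {X : Type*} [DecidableEq X] {n M : ℕ} (f : Fin M → Fin n → X) : Prop :=
  ∀ m m' : Fin M, empiricalDist (f m) = empiricalDist (f m')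

/-- The minimum average error probability of an `(n, R)` constant composition code, that is, one
with `⌈exp (n R)⌉` messages (a minimum over finitely many codes). -/
def minErrorConstComp {X Y : Type*} [DecidableEq X] [Fintype Y] (W : X → Y → ℝ)
    (n : ℕ) (R : ℝ) : ℝ :=
  sInf {e : ℝ | ∃ (f : Fin ⌈Real.exp (n * R)⌉₊ → Fin n → X)
    (φ : (Fin n → Y) → Fin ⌈Real.exp (n * R)⌉₊), IsConstComposition f ∧ e = avgError W f φ}

/-- The numbers `⌈exp (n R)⌉` such that the minimum average error probability of an `(n, R)`
constant composition code is at most `ε`. -/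
def achievableSizes {X Y : Type*} [DecidableEq X] [Fintype Y] (W : X → Y → ℝ)
    (n : ℕ) (ε : ℝ) : Set ℕ :=
  {M : ℕ | ∃ R : ℝ, M = ⌈Real.exp (n * R)⌉₊ ∧ minErrorConstComp W n R ≤ ε}

/-- `M*_c(n, ε)`, the maximum of the achievable code sizes (see `isGreatest_maxSizeConstComp`). -/
def maxSizeConstComp {X Y : Type*} [DecidableEq X] [Fintype Y] (W : X → Y → ℝ)
    (n : ℕ) (ε : ℝ) : ℕ :=
  sSup (achievableSizes W n ε)

theorem avgError_nonneg {X Y : Type*} [Fintype Y] {n M : ℕ} {W : X → Y → ℝ} (hW : IsChannel W)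
    (f : Fin M → Fin n → X) (φ : (Fin n → Y) → Fin M) : 0 ≤ avgError W f φ := by
  unfold avgError
  refine mul_nonneg (by positivity) (Finset.sum_nonneg fun m _ => Finset.sum_nonneg fun y _ =>
    Finset.prod_nonneg fun i _ => (hW _).1 _)

theorem le_avgError {X Y : Type*} [Fintype Y] {n M : ℕ} {W : X → Y → ℝ} (hW : IsChannel W)
    (hM : 0 < M) (f : Fin M → Fin n → X) (φ : (Fin n → Y) → Fin M) :
    1 - (Fintype.card Y : ℝ) ^ n / M ≤ avgError W f φ := by
  have hM' : (0 : ℝ) < M := by exact_mod_cast hM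
  have hle : ∀ x y, W x y ≤ 1 := fun x y => by
    rw [← (hW x).2]
    exact Finset.single_le_sum (fun i _ => (hW x).1 i) (Finset.mem_univ y)
  have htot : ∀ m, ∑ y : Fin n → Y, ∏ i, W (f m i) (y i) = 1 := fun m => by
    have := Finset.prod_univ_sum (fun _ : Fin n => (Finset.univ : Finset Y))
      (fun i y => W (f m i) y)
    rw [Fintype.piFinset_univ] at this
    rw [← this]
    exact Finset.prod_eq_one fun i _ => (hW _).2
  have hsplit : ∀ m, ∑ y : Fin n → Y with φ y ≠ m, ∏ i, W (f m i) (y i)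
      = 1 - ∑ y : Fin n → Y with φ y = m, ∏ i, W (f m i) (y i) := fun m => by
    rw [← htot m, ← Finset.sum_filter_add_sum_filter_not Finset.univ (fun y => φ y = m)]
    ring
  have hcorr : ∑ m, ∑ y : Fin n → Y with φ y = m, ∏ i, W (f m i) (y i)
      ≤ (Fintype.card Y : ℝ) ^ n := by
    calc _ ≤ ∑ m, ∑ y : Fin n → Y with φ y = m, (1 : ℝ) := by
            refine Finset.sum_le_sum fun m _ => Finset.sum_le_sum fun y _ => ?_
            exact Finset.prod_le_one (fun i _ => (hW _).1 _) (fun i _ => hle _ _)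
      _ = ∑ y : Fin n → Y, (1 : ℝ) := Finset.sum_fiberwise _ _ _
      _ = _ := by simp
  unfold avgError
  simp_rw [hsplit]
  rw [Finset.sum_sub_distrib]
  simp only [Finset.sum_const, Finset.card_univ, Fintype.card_fin, nsmul_eq_mul, mul_one]
  rw [mul_sub, one_div, inv_mul_cancel₀ hM'.ne', div_eq_inv_mul]
  gcongr

/-- The maximum that defines `M*_c(n, ε)` exists. -/
theorem isGreatest_maxSizeConstComp {X Y : Type*} [Fintype X] [DecidableEq X] [Fintype Y]
    [Nonempty X] {W : X → Y → ℝ} (hW : IsChannel W) (n : ℕ) {ε : ℝ} (h0 : 0 < ε) (h1 : ε < 1) :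
    IsGreatest (achievableSizes W n ε) (maxSizeConstComp W n ε) := by
  have hne : (achievableSizes W n ε).Nonempty := by
    refine ⟨_, 0, rfl, ?_⟩
    refine le_trans (csInf_le ⟨0, ?_⟩ ⟨fun _ _ => Classical.arbitrary X,
      fun _ => ⟨0, by simp⟩, fun _ _ => rfl, rfl⟩) ?_
    · rintro e ⟨f, φ, -, rfl⟩
      exact avgError_nonneg hW f φ
    · have hs : ∀ m : Fin ⌈Real.exp ((n : ℝ) * 0)⌉₊, (⟨0, by simp⟩ : Fin _) = m := by
        intro m
        have hm := m.2
        ext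
        simp at hm ⊢
        omega
      simp only [avgError]
      rw [Finset.sum_eq_zero]
      · simpa using h0.le
      · intro m _
        rw [Finset.filter_false_of_mem]
        · simp
        · intro y _ h
          exact h (hs m)
  refine ⟨Nat.sSup_mem hne ?_, fun M hM => le_csSup ?_ hM⟩ <;>
  · refine ⟨⌈(Fintype.card Y : ℝ) ^ n / (1 - ε)⌉₊, ?_⟩
    rintro M ⟨R, rfl, hR⟩
    have hpos : 0 < ⌈Real.exp ((n : ℝ) * R)⌉₊ := Nat.ceil_pos.2 (Real.exp_pos _)
    have hpos' : (0 : ℝ) < ⌈Real.exp ((n : ℝ) * R)⌉₊ := by exact_mod_cast hpos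
    have hlow : 1 - (Fintype.card Y : ℝ) ^ n / ⌈Real.exp ((n : ℝ) * R)⌉₊
        ≤ minErrorConstComp W n R := by
      refine le_csInf ⟨_, fun _ _ => Classical.arbitrary X, fun _ => ⟨0, hpos⟩,
        fun _ _ => rfl, rfl⟩ ?_
      rintro e ⟨f, φ, -, rfl⟩
      exact le_avgError hW hpos f φ
    have h2 : 1 - ε ≤ (Fintype.card Y : ℝ) ^ n / ⌈Real.exp ((n : ℝ) * R)⌉₊ := by linarith
    rw [le_div_iff₀ hpos'] at h2
    have h3 : (⌈Real.exp ((n : ℝ) * R)⌉₊ : ℝ) ≤ (Fintype.card Y : ℝ) ^ n / (1 - ε) := by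
      rw [le_div_iff₀ (by linarith)]
      linarith
    exact_mod_cast h3.trans (Nat.le_ceil _)

end NormalApprox

end

namespace NormalApprox

open MeasureTheory ProbabilityTheory Set

/-! For a singular channel every positive entry of column `y` equals one number `w y`, so for any
output distribution `q` the information density is `G y = log (w y / q y)`, a function of the output
alone. The information-spectrum converse `one_le_avgError_add` then contains the truncated moment
`E_q[exp (∑ G); ∑ G ≤ τ]`, whose summands are i.i.d. under `q`. By Berry-Esseen each unit window
carries `q`-mass `O(1/√n)`, so at `τ = log M` the moment is `O(M/√n)` and, after division by `M`, is
of the same order as the normal approximation error. No logarithmic third-order term remains: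
`exists_log_card_le` gives `log M ≤ μ + √v z + K`, where `z` is the normal quantile and `μ`, `v`
depend on the composition only.

It remains to make this uniform over compositions `P`, with `Q` the output distribution of `P` and
`r` the capacity-achieving one. The choice `q = (Q + r) / 2` does two things: `q ≥ r / 2` bounds `G`
uniformly, and `q ≥ Q / 2` makes the variance of `G` under `q` at least half the average conditional
variance (`sum_finVar_le`). The mean falls short of capacity by at least `p + ‖Q - r‖² / 8`, where
`p ≥ 0` is the average defect in the optimality condition (`finMean_mixture_le`). The dispersion
term can exceed its optimal value only by a multiple of `p + ‖Q - r‖`: the capacity-achieving inputs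
are cut out by linear equations, so a Hoffman-type bound applies (`exists_neg_mul_norm_le_sum`,
`exists_dispersion_slack`). After scaling by `n` and `√n`, the loss in the mean absorbs this gain up
to a constant (`neg_mul_add_sqrt_le`).

Berry-Esseen for bounded summands is proved by Stein's method. -/

/-! ### The Gaussian law and Stein's equation -/

/-- The standard normal density. -/
noncomputable def stdPDF (x : ℝ) : ℝ := gaussianPDFReal 0 1 x

/-- The standard normal distribution function. -/
noncomputable def stdCDF (x : ℝ) : ℝ := cdf (gaussianReal 0 1) x

theorem stdPDF_eq (x : ℝ) : stdPDF x = (Real.sqrt (2 * Real.pi))⁻¹ * Real.exp (-x ^ 2 / 2) := by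
  simp [stdPDF, gaussianPDFReal]

theorem stdPDF_pos (x : ℝ) : 0 < stdPDF x := gaussianPDFReal_pos _ _ _ one_ne_zero

theorem stdPDF_neg (x : ℝ) : stdPDF (-x) = stdPDF x := by simp [stdPDF_eq]

theorem stdPDF_abs (x : ℝ) : stdPDF |x| = stdPDF x := by simp [stdPDF_eq]

theorem stdPDF_le_one (x : ℝ) : stdPDF x ≤ 1 := by
  rw [stdPDF_eq]
  have h1 : 1 ≤ Real.sqrt (2 * Real.pi) := by
    rw [Real.one_le_sqrt]; nlinarith [Real.pi_gt_three]
  have h2 : Real.exp (-x ^ 2 / 2) ≤ 1 := Real.exp_le_one_iff.2 (by nlinarith [sq_nonneg x])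
  calc _ ≤ (1 : ℝ) * 1 := mul_le_mul (inv_le_one_of_one_le₀ h1) h2 (Real.exp_pos _).le zero_le_one
    _ = 1 := one_mul 1

theorem continuous_stdPDF : Continuous stdPDF := by
  have : stdPDF = fun x => (Real.sqrt (2 * Real.pi))⁻¹ * Real.exp (-x ^ 2 / 2) :=
    funext stdPDF_eq
  rw [this]
  fun_prop

theorem integrable_stdPDF : Integrable stdPDF := integrable_gaussianPDFReal 0 1

theorem integral_stdPDF : ∫ x, stdPDF x = 1 := integral_gaussianPDFReal_eq_one 0 one_ne_zero

theorem hasDerivAt_stdPDF (x : ℝ) : HasDerivAt stdPDF (-x * stdPDF x) x := by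
  have : stdPDF = fun x => (Real.sqrt (2 * Real.pi))⁻¹ * Real.exp (-x ^ 2 / 2) :=
    funext stdPDF_eq
  rw [this]
  have h1 : HasDerivAt (fun x : ℝ => -x ^ 2 / 2) (-x) x := by
    exact ((hasDerivAt_pow 2 x).fun_neg.div_const 2).congr_deriv (by norm_num; ring)
  exact ((h1.exp).const_mul (Real.sqrt (2 * Real.pi))⁻¹).congr_deriv (by ring)

theorem stdPDF_antitone {x y : ℝ} (h : |x| ≤ |y|) : stdPDF y ≤ stdPDF x := by
  rw [stdPDF_eq, stdPDF_eq]
  have := sq_le_sq.2 h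
  gcongr

theorem stdCDF_eq (z : ℝ) : stdCDF z = ∫ x in Iic z, stdPDF x := by
  rw [stdCDF, cdf_eq_real, Measure.real, gaussianReal_apply_eq_integral 0 one_ne_zero,
    ENNReal.toReal_ofReal (integral_nonneg fun x => gaussianPDFReal_nonneg _ _ _)]
  rfl

theorem stdCDF_mono : Monotone stdCDF := monotone_cdf _

theorem stdCDF_nonneg (x : ℝ) : 0 ≤ stdCDF x := cdf_nonneg _ x

theorem stdCDF_le_one (x : ℝ) : stdCDF x ≤ 1 := cdf_le_one _ x

theorem hasDerivAt_integral_Iic {k : ℝ → ℝ} (hk : Continuous k) (hi : Integrable k) (w : ℝ) :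
    HasDerivAt (fun w => ∫ x in Iic w, k x) (k w) w := by
  have h : (fun w => ∫ x in Iic w, k x) =
      fun w => (∫ x in (0 : ℝ)..w, k x) + ∫ x in Iic (0 : ℝ), k x := by
    funext w
    rw [← intervalIntegral.integral_Iic_sub_Iic hi.integrableOn hi.integrableOn, sub_add_cancel]
  rw [h]
  exact (intervalIntegral.integral_hasDerivAt_right (hk.intervalIntegrable _ _)
    (hk.stronglyMeasurableAtFilter _ _) hk.continuousAt).add_const _

theorem hasDerivAt_stdCDF (z : ℝ) : HasDerivAt stdCDF (stdPDF z) z := by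
  rw [show stdCDF = _ from funext stdCDF_eq]
  exact hasDerivAt_integral_Iic continuous_stdPDF integrable_stdPDF z

theorem stdCDF_neg (z : ℝ) : stdCDF (-z) = ∫ x in Ioi z, stdPDF x := by
  rw [stdCDF_eq, ← integral_comp_neg_Ioi]
  simp [stdPDF_neg]

theorem stdCDF_add_neg (z : ℝ) : stdCDF z + stdCDF (-z) = 1 := by
  rw [stdCDF_neg, stdCDF_eq, ← integral_stdPDF, ← compl_Iic]
  exact integral_add_compl measurableSet_Iic integrable_stdPDF

theorem stdCDF_zero : stdCDF 0 = 1 / 2 := by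
  have := stdCDF_add_neg 0
  rw [neg_zero] at this
  linarith

theorem stdCDF_sub_le {x y : ℝ} (h : x ≤ y) : stdCDF y - stdCDF x ≤ y - x := by
  have := image_sub_le_mul_sub_of_deriv_le (f := stdCDF) (C := 1)
    (fun x => (hasDerivAt_stdCDF x).differentiableAt)
    (fun x => by rw [(hasDerivAt_stdCDF x).deriv]; exact stdPDF_le_one x) h
  linarith

/-- Mills' ratio. Since `(x + w)² ≥ 0`, the density is dominated by an exponential in `x` that
touches it at `-w`; integrating the exponential gives the bound. -/
theorem mul_stdCDF_neg_le {w : ℝ} (hw : 0 < w) : w * stdCDF (-w) ≤ stdPDF w := by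
  have hle : stdCDF (-w) ≤ ∫ x in Iic (-w), stdPDF w * Real.exp (w ^ 2) * Real.exp (w * x) := by
    rw [stdCDF_eq]
    refine setIntegral_mono integrable_stdPDF.integrableOn
      ((integrableOn_exp_mul_Iic hw _).const_mul _) fun x => ?_
    rw [stdPDF_eq, stdPDF_eq, mul_assoc, mul_assoc, ← Real.exp_add, ← Real.exp_add]
    gcongr
    nlinarith [sq_nonneg (x + w)]
  rw [integral_const_mul, integral_exp_mul_Iic hw] at hle
  calc w * stdCDF (-w)
      ≤ w * (stdPDF w * Real.exp (w ^ 2) * (Real.exp (w * -w) / w)) := by gcongr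
    _ = stdPDF w * (Real.exp (w ^ 2) * Real.exp (w * -w)) := by field_simp
    _ = stdPDF w := by rw [← Real.exp_add]; simp [pow_two]

theorem stdCDF_neg_le {w : ℝ} (hw : 0 ≤ w) : stdPDF 1 * stdCDF (-w) ≤ stdPDF w := by
  rcases le_total w 1 with h | h
  · calc stdPDF 1 * stdCDF (-w) ≤ stdPDF 1 * 1 :=
          mul_le_mul_of_nonneg_left (stdCDF_le_one _) (stdPDF_pos 1).le
      _ ≤ stdPDF w := by
          rw [mul_one]
          exact stdPDF_antitone (by rwa [abs_of_nonneg hw, abs_one])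
  · calc stdPDF 1 * stdCDF (-w) ≤ w * stdCDF (-w) :=
          mul_le_mul_of_nonneg_right ((stdPDF_le_one 1).trans h) (stdCDF_nonneg _)
      _ ≤ stdPDF w := mul_stdCDF_neg_le (by linarith)

/-- Bounds for a solution of Stein's equation `f' w = w * f w + h w - E h(Z)` with a continuous
right-hand side `0 ≤ h ≤ 1`. -/
theorem exists_stein_solution {h : ℝ → ℝ} (hc : Continuous h) (h0 : ∀ x, 0 ≤ h x)
    (h1 : ∀ x, h x ≤ 1) :
    ∃ f : ℝ → ℝ, ∀ w, HasDerivAt f (w * f w + h w - ∫ x, h x * stdPDF x) w ∧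
      |f w| ≤ 1 / stdPDF 1 ∧ |w * f w + h w - ∫ x, h x * stdPDF x| ≤ 2 := by
  set N := ∫ x, h x * stdPDF x with hN
  have hhi : Integrable fun x => h x * stdPDF x := by
    refine integrable_stdPDF.mono (hc.mul continuous_stdPDF).aestronglyMeasurable
      (Filter.Eventually.of_forall fun x => ?_)
    rw [Real.norm_eq_abs, Real.norm_eq_abs, abs_of_nonneg (mul_nonneg (h0 x) (stdPDF_pos x).le),
      abs_of_pos (stdPDF_pos x)]
    exact mul_le_of_le_one_left (stdPDF_pos x).le (h1 x)
  have hN0 : 0 ≤ N := integral_nonneg fun x => mul_nonneg (h0 x) (stdPDF_pos x).le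
  have hN1 : N ≤ 1 := by
    rw [← integral_stdPDF]
    exact integral_mono hhi integrable_stdPDF
      fun x => mul_le_of_le_one_left (stdPDF_pos x).le (h1 x)
  have hK : ∀ x, |h x - N| ≤ 1 := fun x =>
    abs_le.2 ⟨by linarith [h0 x], by linarith [h1 x]⟩
  let k : ℝ → ℝ := fun x => (h x - N) * stdPDF x
  have hkc : Continuous k := (hc.sub continuous_const).mul continuous_stdPDF
  have hki : Integrable k := by
    have := hhi.sub (integrable_stdPDF.const_mul N)
    refine this.congr (Filter.Eventually.of_forall fun x => ?_)
    simp only [k, Pi.sub_apply]; ring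
  have hkabs : ∀ x, |k x| ≤ stdPDF x := fun x => by
    rw [abs_mul, abs_of_pos (stdPDF_pos x)]
    exact mul_le_of_le_one_left (stdPDF_pos x).le (hK x)
  have hk0 : ∫ x, k x = 0 := by
    have : (fun x => k x) = fun x => h x * stdPDF x - N * stdPDF x := by
      funext x; simp only [k]; ring
    rw [this, integral_sub hhi (integrable_stdPDF.const_mul N), integral_const_mul,
      integral_stdPDF, mul_one, sub_self]
  let F : ℝ → ℝ := fun w => ∫ x in Iic w, k x
  have hset : ∀ s : Set ℝ, |∫ x in s, k x| ≤ ∫ x in s, stdPDF x := fun s => by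
    refine (abs_integral_le_integral_abs).trans ?_
    exact setIntegral_mono hki.abs.integrableOn integrable_stdPDF.integrableOn hkabs
  -- As `k` has total integral zero, `F w` is also minus the upper tail integral, so the smaller of
  -- the two Gaussian tails controls it.
  have hF : ∀ w, |F w| ≤ stdCDF (-|w|) := fun w => by
    rcases le_total w 0 with hw | hw
    · rw [abs_of_nonpos hw, neg_neg, stdCDF_eq]
      exact hset _
    · rw [abs_of_nonneg hw, stdCDF_neg]
      have : F w = -∫ x in Ioi w, k x := by
        have := integral_add_compl (measurableSet_Iic (a := w)) hki
        rw [hk0, compl_Iic] at this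
        simp only [F]; linarith
      rw [this, abs_neg]
      exact hset _
  have hwf : ∀ w, |w * (F w / stdPDF w)| ≤ 1 := fun w => by
    rw [abs_mul, abs_div, abs_of_pos (stdPDF_pos w), ← mul_div_assoc, div_le_one (stdPDF_pos w)]
    rcases eq_or_ne w 0 with rfl | hw
    · simpa using (stdPDF_pos 0).le
    · calc |w| * |F w| ≤ |w| * stdCDF (-|w|) := by gcongr; exact hF w
        _ ≤ stdPDF |w| := mul_stdCDF_neg_le (abs_pos.2 hw)
        _ = stdPDF w := stdPDF_abs w
  refine ⟨fun w => F w / stdPDF w, fun w => ⟨?_, ?_, ?_⟩⟩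
  · have hd := (hasDerivAt_integral_Iic hkc hki w).div (hasDerivAt_stdPDF w) (stdPDF_pos w).ne'
    refine hd.congr_deriv ?_
    have := (stdPDF_pos w).ne'
    simp only [k, F]
    field_simp
    ring
  · rw [abs_div, abs_of_pos (stdPDF_pos w), div_le_div_iff₀ (stdPDF_pos w) (stdPDF_pos 1), one_mul]
    calc |F w| * stdPDF 1 ≤ stdCDF (-|w|) * stdPDF 1 :=
          mul_le_mul_of_nonneg_right (hF w) (stdPDF_pos 1).le
      _ ≤ stdPDF |w| := by rw [mul_comm]; exact stdCDF_neg_le (abs_nonneg w)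
      _ = stdPDF w := stdPDF_abs w
  · have e : w * (F w / stdPDF w) + h w - N = w * (F w / stdPDF w) + (h w - N) := by ring
    rw [e]
    exact (abs_add_le _ _).trans (by linarith [hwf w, hK w])

/-! ### Product expectations and the Berry-Esseen inequality -/

section ProductExpectation

variable {ι Y : Type*} [Fintype ι] [DecidableEq ι] [Fintype Y]

/-- The expectation of `h` under the product of the finite distributions `p i`. -/
noncomputable def prodExp (p : ι → Y → ℝ) (h : (ι → Y) → ℝ) : ℝ := ∑ y, (∏ i, p i (y i)) * h y

theorem prodExp_add (p : ι → Y → ℝ) (g h : (ι → Y) → ℝ) :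
    prodExp p (fun y => g y + h y) = prodExp p g + prodExp p h := by
  simp only [prodExp, mul_add, Finset.sum_add_distrib]

theorem prodExp_sub (p : ι → Y → ℝ) (g h : (ι → Y) → ℝ) :
    prodExp p (fun y => g y - h y) = prodExp p g - prodExp p h := by
  simp only [prodExp, mul_sub, Finset.sum_sub_distrib]

theorem prodExp_const_mul (p : ι → Y → ℝ) (c : ℝ) (h : (ι → Y) → ℝ) :
    prodExp p (fun y => c * h y) = c * prodExp p h := by
  simp only [prodExp, Finset.mul_sum]
  exact Finset.sum_congr rfl fun y _ => by ring

theorem prodExp_sum {κ : Type*} (s : Finset κ) (p : ι → Y → ℝ) (h : κ → (ι → Y) → ℝ) :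
    prodExp p (fun y => ∑ j ∈ s, h j y) = ∑ j ∈ s, prodExp p (h j) := by
  simp only [prodExp, Finset.mul_sum]
  exact Finset.sum_comm

theorem prodExp_mono {p : ι → Y → ℝ} (hp : ∀ i, p i ∈ stdSimplex ℝ Y) {g h : (ι → Y) → ℝ}
    (hgh : ∀ y, g y ≤ h y) : prodExp p g ≤ prodExp p h :=
  Finset.sum_le_sum fun y _ =>
    mul_le_mul_of_nonneg_left (hgh y) (Finset.prod_nonneg fun i _ => (hp i).1 _)

theorem prodExp_const {p : ι → Y → ℝ} (hp : ∀ i, p i ∈ stdSimplex ℝ Y) (c : ℝ) :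
    prodExp p (fun _ => c) = c := by
  have := Finset.prod_univ_sum (fun _ : ι => (Finset.univ : Finset Y)) (fun i y => p i y)
  rw [Fintype.piFinset_univ, Finset.prod_eq_one fun i _ => (hp i).2] at this
  rw [prodExp, ← Finset.sum_mul, ← this, one_mul]

/-- Exchanging coordinate `i` with an independent copy is an involution that preserves the joint
weight. -/
theorem prodExp_resample {p : ι → Y → ℝ} (hp : ∀ i, p i ∈ stdSimplex ℝ Y) (i : ι)
    (h : (ι → Y) → ℝ) :
    prodExp p h = prodExp p (fun y => ∑ b, p i b * h (Function.update y i b)) := by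
  let e : (ι → Y) × Y ≃ (ι → Y) × Y :=
    { toFun := fun z => (Function.update z.1 i z.2, z.1 i)
      invFun := fun z => (Function.update z.1 i z.2, z.1 i)
      left_inv := fun z => by simp
      right_inv := fun z => by simp }
  have hw : ∀ (y : ι → Y) (b : Y), (∏ j, p j (y j)) * p i b =
      (∏ j, p j (Function.update y i b j)) * p i (y i) := fun y b => by
    rw [← Finset.mul_prod_erase _ _ (Finset.mem_univ i),
      ← Finset.mul_prod_erase _ _ (Finset.mem_univ i)]
    have : ∏ j ∈ Finset.univ.erase i, p j (Function.update y i b j) =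
        ∏ j ∈ Finset.univ.erase i, p j (y j) :=
      Finset.prod_congr rfl fun j hj => by
        rw [Function.update_of_ne (Finset.ne_of_mem_erase hj)]
    rw [this, Function.update_self]
    ring
  have h1 : prodExp p (fun y => ∑ b, p i b * h (Function.update y i b)) =
      ∑ z : (ι → Y) × Y, (fun z : (ι → Y) × Y => (∏ j, p j (z.1 j)) * p i z.2 * h z.1) (e z) := by
    rw [Fintype.sum_prod_type, prodExp]
    refine Finset.sum_congr rfl fun y _ => ?_
    rw [Finset.mul_sum]
    refine Finset.sum_congr rfl fun b _ => ?_
    simp only [e, Equiv.coe_fn_mk]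
    rw [← hw, mul_assoc]
  rw [h1, Equiv.sum_comp e (fun z : (ι → Y) × Y => (∏ j, p j (z.1 j)) * p i z.2 * h z.1),
    Fintype.sum_prod_type, prodExp]
  refine Finset.sum_congr rfl fun y _ => ?_
  simp only
  rw [← Finset.sum_mul, ← Finset.mul_sum, (hp i).2, mul_one]

/-- Resample coordinate `i` in the `i`-th term; the subtracted value of `f` does not involve the new
letter `b`, so it contributes nothing because `ξ i` is centred. -/
theorem stein_identity {p : ι → Y → ℝ} (hp : ∀ i, p i ∈ stdSimplex ℝ Y) {ξ : ι → Y → ℝ}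
    (hξ : ∀ i, ∑ b, p i b * ξ i b = 0) (f : ℝ → ℝ) :
    prodExp p (fun y => (∑ i, ξ i (y i)) * f (∑ i, ξ i (y i))) =
      ∑ i, prodExp p (fun y => ∑ b, p i b * (ξ i b *
        (f (∑ j, ξ j (y j) - ξ i (y i) + ξ i b) - f (∑ j, ξ j (y j) - ξ i (y i))))) := by
  simp only [Finset.sum_mul]
  rw [prodExp_sum]
  refine Finset.sum_congr rfl fun i _ => ?_
  rw [prodExp_resample hp i]
  congr 1
  funext y
  have hS : ∀ b, ∑ j, ξ j (Function.update y i b j) = ∑ j, ξ j (y j) - ξ i (y i) + ξ i b := by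
    intro b
    rw [← Finset.add_sum_erase _ _ (Finset.mem_univ i),
      ← Finset.add_sum_erase (a := i) _ (fun j => ξ j (y j)) (Finset.mem_univ i)]
    have : ∑ j ∈ Finset.univ.erase i, ξ j (Function.update y i b j) =
        ∑ j ∈ Finset.univ.erase i, ξ j (y j) :=
      Finset.sum_congr rfl fun j hj => by
        rw [Function.update_of_ne (Finset.ne_of_mem_erase hj)]
    rw [this, Function.update_self]
    ring
  simp only [hS, Function.update_self, mul_sub, Finset.sum_sub_distrib]
  have : ∑ b, p i b * (ξ i b * f (∑ j, ξ j (y j) - ξ i (y i))) = 0 := by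
    simp only [← mul_assoc, ← Finset.sum_mul, hξ, zero_mul]
  rw [this, sub_zero]

theorem prodExp_sq_sum {p : ι → Y → ℝ} (hp : ∀ i, p i ∈ stdSimplex ℝ Y) {ξ : ι → Y → ℝ}
    (hξ : ∀ i, ∑ b, p i b * ξ i b = 0) :
    prodExp p (fun y => (∑ i, ξ i (y i)) ^ 2) = ∑ i, ∑ b, p i b * ξ i b ^ 2 := by
  have := stein_identity hp hξ id
  simp only [id, add_sub_cancel_left] at this
  simp only [pow_two]
  rw [this]
  exact Finset.sum_congr rfl fun i _ => prodExp_const hp _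

/-- Stein's method without a concentration inequality. The identity expresses `E[S f(S)]` through
values of `f'` at points within `2 * δ` of `S`. Stein's equation bounds these below by `S f(S) +
g(S)` minus the normal mean of `h` and a small error, and the terms `E[S f(S)]` cancel. -/
theorem prodExp_le_of_ramp {p : ι → Y → ℝ} (hp : ∀ i, p i ∈ stdSimplex ℝ Y) {ξ : ι → Y → ℝ}
    (hξ : ∀ i, ∑ b, p i b * ξ i b = 0) (hvar : ∑ i, ∑ b, p i b * ξ i b ^ 2 = 1)
    {δ : ℝ} (hδ : ∀ i b, |ξ i b| ≤ δ) (hδ0 : 0 ≤ δ) {h g : ℝ → ℝ} (hc : Continuous h)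
    (h0 : ∀ x, 0 ≤ h x) (h1 : ∀ x, h x ≤ 1) (hg : ∀ u w, |u - w| ≤ 2 * δ → g w ≤ h u) :
    prodExp p (fun y => g (∑ i, ξ i (y i))) ≤
      (∫ x, h x * stdPDF x) + 2 * δ * (2 + 1 / stdPDF 1) := by
  obtain ⟨f, hf⟩ := exists_stein_solution hc h0 h1
  set N := ∫ x, h x * stdPDF x
  set c := 1 / stdPDF 1
  let S : (ι → Y) → ℝ := fun y => ∑ i, ξ i (y i)
  have hlip : ∀ u w, |f u - f w| ≤ 2 * |u - w| := fun u w =>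
    Convex.norm_image_sub_le_of_norm_hasDerivWithin_le (s := univ)
      (fun x _ => (hf x).1.hasDerivWithinAt) (fun x _ => (hf x).2.2) convex_univ trivial trivial
  -- A lower bound for `f'` on the `2 * δ`-neighbourhood of `w`; the loss combines the Lipschitz
  -- constant `2` of `f`, weighted by `|w|`, with the sup bound `c`.
  let m : ℝ → ℝ := fun w => w * f w - 2 * δ * (2 * |w| + c) + g w - N
  have hm : ∀ u w, |u - w| ≤ 2 * δ → m w ≤ u * f u + h u - N := fun u w huw => by
    have e : w * f w - u * f u = w * (f w - f u) - (u - w) * f u := by ring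
    have h2 : |w * (f w - f u)| ≤ |w| * (2 * (2 * δ)) := by
      rw [abs_mul]
      gcongr
      rw [abs_sub_comm]
      exact (hlip u w).trans (by linarith)
    have h3 : |(u - w) * f u| ≤ 2 * δ * c := by
      rw [abs_mul]
      exact mul_le_mul huw (hf u).2.1 (abs_nonneg _) (by linarith)
    have h4 := hg u w huw
    have h5 := le_abs_self (w * (f w - f u))
    have h6 := neg_abs_le ((u - w) * f u)
    simp only [m]
    nlinarith
  have key : ∀ (y : ι → Y) i b, ξ i b ^ 2 * m (S y) ≤
      ξ i b * (f (S y - ξ i (y i) + ξ i b) - f (S y - ξ i (y i))) := fun y i b => by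
    set v := S y - ξ i (y i) with hv
    have hd : ∀ s : ℝ, HasDerivAt (fun s => f (v + s * ξ i b))
        (((v + s * ξ i b) * f (v + s * ξ i b) + h (v + s * ξ i b) - N) * ξ i b) s := fun s => by
      have hl : HasDerivAt (fun s : ℝ => v + s * ξ i b) (ξ i b) s := by
        simpa using ((hasDerivAt_id s).mul_const (ξ i b)).const_add v
      exact (hf (v + s * ξ i b)).1.comp s hl
    -- The mean value theorem is applied along `s ↦ v + s * ξ i b`, which also covers `ξ i b = 0`.
    obtain ⟨s, hs, hs'⟩ := exists_hasDerivAt_eq_slope (fun s => f (v + s * ξ i b)) _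
      (zero_lt_one' ℝ) (fun s _ => (hd s).continuousAt.continuousWithinAt) (fun s _ => hd s)
    simp only [one_mul, zero_mul, add_zero, sub_zero, div_one] at hs'
    rw [← hs']
    have hb : |v + s * ξ i b - S y| ≤ 2 * δ := by
      have : v + s * ξ i b - S y = s * ξ i b - ξ i (y i) := by rw [hv]; ring
      rw [this]
      refine (abs_sub _ _).trans ?_
      rw [abs_mul, abs_of_pos hs.1]
      nlinarith [hδ i b, hδ i (y i), hs.1, hs.2, abs_nonneg (ξ i b)]
    calc ξ i b ^ 2 * m (S y) ≤ ξ i b ^ 2 * ((v + s * ξ i b) * f (v + s * ξ i b) +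
          h (v + s * ξ i b) - N) := by gcongr; exact hm _ _ hb
      _ = _ := by ring
  have hE : prodExp p (fun y => m (S y)) ≤ prodExp p (fun y => S y * f (S y)) := by
    rw [stein_identity hp hξ f]
    calc prodExp p (fun y => m (S y))
        = ∑ i, prodExp p (fun y => (∑ b, p i b * ξ i b ^ 2) * m (S y)) := by
          simp only [prodExp_const_mul]
          rw [← Finset.sum_mul, hvar, one_mul]
      _ ≤ _ := by
          refine Finset.sum_le_sum fun i _ => prodExp_mono hp fun y => ?_
          rw [Finset.sum_mul]
          refine Finset.sum_le_sum fun b _ => ?_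
          rw [mul_assoc]
          exact mul_le_mul_of_nonneg_left (key y i b) ((hp i).1 b)
  have hexp : prodExp p (fun y => m (S y)) = prodExp p (fun y => S y * f (S y))
      - (2 * δ * 2 * prodExp p (fun y => |S y|) + 2 * δ * c)
      + prodExp p (fun y => g (S y)) - N := by
    have : (fun y => m (S y)) = fun y => S y * f (S y) - (2 * δ * 2 * |S y| + 2 * δ * c) +
        g (S y) - N := by
      funext y; simp only [m]; ring
    rw [this, prodExp_sub, prodExp_add, prodExp_sub, prodExp_add, prodExp_const_mul,
      prodExp_const hp, prodExp_const hp]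
  have habs : prodExp p (fun y => |S y|) ≤ 1 := by
    calc prodExp p (fun y => |S y|) ≤ prodExp p (fun y => 1 / 2 * (S y) ^ 2 + 1 / 2) :=
          prodExp_mono hp fun y => by nlinarith [sq_nonneg (|S y| - 1), sq_abs (S y)]
      _ = 1 := by
          rw [prodExp_add, prodExp_const_mul, prodExp_const hp, prodExp_sq_sum hp hξ, hvar]
          norm_num
  have : 2 * δ * 2 * prodExp p (fun y => |S y|) ≤ 2 * δ * 2 * 1 := by gcongr
  change prodExp p (fun y => g (S y)) ≤ _
  linarith

/-- The continuous function that is `1` on `(-∞, a]`, `0` on `[a + δ, ∞)` and affine between. -/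
noncomputable def ramp (a δ x : ℝ) : ℝ := max 0 (min 1 ((a + δ - x) / δ))

theorem continuous_ramp (a δ : ℝ) : Continuous (ramp a δ) := by
  unfold ramp; fun_prop

theorem ramp_nonneg (a δ x : ℝ) : 0 ≤ ramp a δ x := le_max_left _ _

theorem ramp_le_one (a δ x : ℝ) : ramp a δ x ≤ 1 := max_le zero_le_one (min_le_left _ _)

theorem ramp_eq_one {a δ x : ℝ} (hδ : 0 < δ) (h : x ≤ a) : ramp a δ x = 1 := by
  have : 1 ≤ (a + δ - x) / δ := by rw [le_div_iff₀ hδ]; linarith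
  rw [ramp, min_eq_left this, max_eq_right zero_le_one]

theorem ramp_eq_zero {a δ x : ℝ} (hδ : 0 < δ) (h : a + δ ≤ x) : ramp a δ x = 0 :=
  max_eq_left ((min_le_right _ _).trans (div_nonpos_of_nonpos_of_nonneg (by linarith) hδ.le))

theorem integrable_ramp_mul (a δ : ℝ) : Integrable fun x => ramp a δ x * stdPDF x := by
  refine integrable_stdPDF.mono
    ((continuous_ramp a δ).mul continuous_stdPDF).aestronglyMeasurable
    (Filter.Eventually.of_forall fun x => ?_)
  rw [Real.norm_eq_abs, Real.norm_eq_abs, abs_of_pos (stdPDF_pos x),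
    abs_of_nonneg (mul_nonneg (ramp_nonneg _ _ _) (stdPDF_pos x).le)]
  exact mul_le_of_le_one_left (stdPDF_pos x).le (ramp_le_one _ _ _)

theorem integral_ramp_le {a δ : ℝ} (hδ : 0 < δ) :
    ∫ x, ramp a δ x * stdPDF x ≤ stdCDF (a + δ) := by
  rw [stdCDF_eq, ← integral_indicator measurableSet_Iic]
  refine integral_mono (integrable_ramp_mul a δ)
    (integrable_stdPDF.indicator measurableSet_Iic) fun x => ?_
  by_cases hx : x ≤ a + δ
  · rw [indicator_of_mem (by exact hx)]
    exact mul_le_of_le_one_left (stdPDF_pos x).le (ramp_le_one _ _ _)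
  · rw [indicator_of_notMem (by exact hx)]
    simp [ramp_eq_zero hδ (not_le.1 hx).le]

theorem le_integral_ramp {a δ : ℝ} (hδ : 0 < δ) :
    stdCDF a ≤ ∫ x, ramp a δ x * stdPDF x := by
  rw [stdCDF_eq, ← integral_indicator measurableSet_Iic]
  refine integral_mono (integrable_stdPDF.indicator measurableSet_Iic)
    (integrable_ramp_mul a δ) fun x => ?_
  by_cases hx : x ≤ a
  · rw [indicator_of_mem (by exact hx)]
    simp [ramp_eq_one hδ hx]
  · rw [indicator_of_notMem (by exact hx)]
    exact mul_nonneg (ramp_nonneg _ _ _) (stdPDF_pos x).le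

/-- The constant in the Berry-Esseen bound. -/
noncomputable def berryConst : ℝ := 3 + 2 * (2 + 1 / stdPDF 1)

theorem berryConst_pos : 0 < berryConst := by
  have := stdPDF_pos 1
  unfold berryConst; positivity

open Classical in
/-- The Berry-Esseen inequality for bounded, normalised summands. -/
theorem berry_esseen_normalized {p : ι → Y → ℝ} (hp : ∀ i, p i ∈ stdSimplex ℝ Y) {ξ : ι → Y → ℝ}
    (hξ : ∀ i, ∑ b, p i b * ξ i b = 0) (hvar : ∑ i, ∑ b, p i b * ξ i b ^ 2 = 1)
    {δ : ℝ} (hδ : ∀ i b, |ξ i b| ≤ δ) (hδ0 : 0 < δ) (t : ℝ) :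
    |prodExp p (fun y => if ∑ i, ξ i (y i) ≤ t then 1 else 0) - stdCDF t| ≤ berryConst * δ := by
  rw [abs_le]
  constructor
  -- The ramp must vanish from `t - 2 * δ` on, so it starts at `t - 3 * δ`. In the other direction
  -- it equals `1` up to `t + 2 * δ` and ends at `t + 3 * δ`; this is the `3` in `berryConst`.
  · have h1 := prodExp_le_of_ramp hp hξ hvar hδ hδ0.le (h := fun x => 1 - ramp (t - 3 * δ) δ x)
      (g := fun w => 1 - if w ≤ t then 1 else 0)
      (continuous_const.sub (continuous_ramp _ _))
      (fun x => by linarith [ramp_le_one (t - 3 * δ) δ x])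
      (fun x => by linarith [ramp_nonneg (t - 3 * δ) δ x])
      (fun u w huw => by
        split_ifs with hw
        · linarith [ramp_le_one (t - 3 * δ) δ u]
        · rw [ramp_eq_zero hδ0]
          have := abs_le.1 huw
          linarith)
    have h2 : ∫ x, (1 - ramp (t - 3 * δ) δ x) * stdPDF x ≤ 1 - stdCDF (t - 3 * δ) := by
      have : (fun x => (1 - ramp (t - 3 * δ) δ x) * stdPDF x) =
          fun x => stdPDF x - ramp (t - 3 * δ) δ x * stdPDF x := by funext x; ring
      rw [this, integral_sub integrable_stdPDF (integrable_ramp_mul _ _), integral_stdPDF]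
      linarith [le_integral_ramp (a := t - 3 * δ) hδ0]
    rw [prodExp_sub, prodExp_const hp] at h1
    have h3 := stdCDF_sub_le (x := t - 3 * δ) (y := t) (by linarith)
    unfold berryConst
    linarith
  · have h1 := prodExp_le_of_ramp hp hξ hvar hδ hδ0.le (h := ramp (t + 2 * δ) δ)
      (g := fun w => if w ≤ t then 1 else 0) (continuous_ramp _ _) (ramp_nonneg _ _)
      (ramp_le_one _ _)
      (fun u w huw => by
        split_ifs with hw
        · rw [ramp_eq_one hδ0]
          have := abs_le.1 huw
          linarith
        · exact ramp_nonneg _ _ _)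
    have h2 := integral_ramp_le (a := t + 2 * δ) hδ0
    have h3 := stdCDF_sub_le (x := t) (y := t + 2 * δ + δ) (by linarith)
    unfold berryConst
    linarith

/-- The mean of `G` under `p`. -/
noncomputable def finMean (p G : Y → ℝ) : ℝ := ∑ b, p b * G b

/-- The variance of `G` under `p`. -/
noncomputable def finVar (p G : Y → ℝ) : ℝ := ∑ b, p b * (G b - finMean p G) ^ 2

theorem finVar_nonneg {p : Y → ℝ} (hp : p ∈ stdSimplex ℝ Y) (G : Y → ℝ) : 0 ≤ finVar p G :=
  Finset.sum_nonneg fun b _ => mul_nonneg (hp.1 b) (sq_nonneg _)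

theorem sum_mul_sub_finMean {p : Y → ℝ} (hp : p ∈ stdSimplex ℝ Y) (G : Y → ℝ) :
    ∑ b, p b * (G b - finMean p G) = 0 := by
  simp only [mul_sub, Finset.sum_sub_distrib, ← Finset.sum_mul, hp.2, one_mul]
  exact sub_self _

theorem abs_finMean_le {p : Y → ℝ} (hp : p ∈ stdSimplex ℝ Y) {G : Y → ℝ} {A : ℝ}
    (hG : ∀ b, |G b| ≤ A) : |finMean p G| ≤ A := by
  calc |finMean p G| ≤ ∑ b, |p b * G b| := Finset.abs_sum_le_sum_abs _ _
    _ ≤ ∑ b, p b * A := Finset.sum_le_sum fun b _ => by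
        rw [abs_mul, abs_of_nonneg (hp.1 b)]
        exact mul_le_mul_of_nonneg_left (hG b) (hp.1 b)
    _ = A := by rw [← Finset.sum_mul, hp.2, one_mul]

open Classical in
/-- The Berry-Esseen inequality for a sum of independent bounded summands `G (y i)`. -/
theorem berry_esseen {p : ι → Y → ℝ} (hp : ∀ i, p i ∈ stdSimplex ℝ Y) {G : Y → ℝ} {A : ℝ}
    (hA : 0 < A) (hG : ∀ b, |G b| ≤ A) {s : ℝ} (hs : 0 < s) (hs2 : s ^ 2 = ∑ i, finVar (p i) G)
    (t : ℝ) :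
    |prodExp p (fun y => if ∑ i, G (y i) ≤ t then 1 else 0) -
      stdCDF ((t - ∑ i, finMean (p i) G) / s)| ≤ berryConst * (2 * A / s) := by
  have h := berry_esseen_normalized hp (ξ := fun i b => (G b - finMean (p i) G) / s)
    (fun i => by
      simp only [← mul_div_assoc, ← Finset.sum_div, sum_mul_sub_finMean (hp i), zero_div])
    (by
      simp only [div_pow, ← mul_div_assoc, ← Finset.sum_div]
      rw [hs2]
      exact div_self (hs2 ▸ (pow_pos hs 2).ne'))
    (δ := 2 * A / s)
    (fun i b => by
      rw [abs_div, abs_of_pos hs]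
      gcongr
      refine (abs_sub _ _).trans ?_
      linarith [hG b, abs_finMean_le (hp i) hG])
    (by positivity) ((t - ∑ i, finMean (p i) G) / s)
  simp only [← Finset.sum_div, Finset.sum_sub_distrib, div_le_div_iff_of_pos_right hs,
    sub_le_sub_iff_right] at h
  exact h

open Classical in
/-- Chebyshev's inequality for a sum of independent summands `G (y i)`. -/
theorem chebyshev_prodExp {p : ι → Y → ℝ} (hp : ∀ i, p i ∈ stdSimplex ℝ Y) (G : Y → ℝ)
    {r : ℝ} (hr : 0 < r) :
    prodExp p (fun y => if ∑ i, G (y i) ≤ ∑ i, finMean (p i) G + r then 0 else 1) ≤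
      (∑ i, finVar (p i) G) / r ^ 2 := by
  have h := prodExp_sq_sum hp (ξ := fun i b => G b - finMean (p i) G)
    (fun i => sum_mul_sub_finMean (hp i) G)
  have h2 : ∑ i, finVar (p i) G = ∑ i, ∑ b, p i b * (G b - finMean (p i) G) ^ 2 := rfl
  rw [h2, ← h, div_eq_inv_mul, ← prodExp_const_mul]
  refine prodExp_mono hp fun y => ?_
  rw [Finset.sum_sub_distrib, inv_mul_eq_div]
  split_ifs with hy
  · positivity
  · rw [one_le_div (by positivity)]
    gcongr
    linarith

end ProductExpectation

/-! ### The normal quantile -/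

section Quantile

theorem continuous_stdCDF : Continuous stdCDF :=
  continuous_iff_continuousAt.2 fun x => (hasDerivAt_stdCDF x).continuousAt

theorem strictMono_stdCDF : StrictMono stdCDF :=
  strictMono_of_deriv_pos fun x => by
    rw [(hasDerivAt_stdCDF x).deriv]; exact stdPDF_pos x

theorem quantileSet_nonempty {ε : ℝ} (h1 : ε < 1) : {z | ε ≤ stdCDF z}.Nonempty :=
  ((ProbabilityTheory.tendsto_cdf_atTop _).eventually (eventually_ge_nhds h1)).exists

theorem quantileSet_bddBelow {ε : ℝ} (h0 : 0 < ε) : BddBelow {z | ε ≤ stdCDF z} := by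
  obtain ⟨z, hz⟩ := ((ProbabilityTheory.tendsto_cdf_atBot
    (ProbabilityTheory.gaussianReal 0 1)).eventually (eventually_lt_nhds h0)).exists
  refine ⟨z, fun w hw => ?_⟩
  by_contra h
  exact absurd (stdCDF_mono (not_le.1 h).le) (not_le.2 (lt_of_lt_of_le hz hw))

theorem le_stdCDF_quantile {ε : ℝ} (h0 : 0 < ε) (h1 : ε < 1) :
    ε ≤ stdCDF (stdNormalQuantile ε) :=
  (isClosed_le continuous_const continuous_stdCDF).csInf_mem (quantileSet_nonempty h1)
    (quantileSet_bddBelow h0)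

theorem stdNormalQuantile_nonpos {ε : ℝ} (h0 : 0 < ε) (h1 : ε ≤ 1 / 2) :
    stdNormalQuantile ε ≤ 0 :=
  csInf_le (quantileSet_bddBelow h0) (show ε ≤ stdCDF 0 by rwa [stdCDF_zero])

theorem stdNormalQuantile_nonneg {ε : ℝ} (h0 : 1 / 2 < ε) (h1 : ε < 1) :
    0 ≤ stdNormalQuantile ε :=
  le_csInf (quantileSet_nonempty h1) fun z (hz : ε ≤ stdCDF z) => by
    refine (strictMono_stdCDF.lt_iff_lt.1 ?_).le
    rw [stdCDF_zero]
    linarith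

/-- On `[z, z + 1]`, where `z` is the quantile, the normal density is at least its value at `|z| +
1`, so an excess in probability turns into a linear excess in the argument. -/
theorem le_quantile_add {ε : ℝ} (h0 : 0 < ε) (h1 : ε < 1) {h u : ℝ} (hh0 : 0 ≤ h) (hh1 : h ≤ 1)
    (hu : stdCDF u ≤ ε + stdPDF (|stdNormalQuantile ε| + 1) * h) :
    u ≤ stdNormalQuantile ε + h := by
  set z := stdNormalQuantile ε
  set κ := stdPDF (|z| + 1)
  by_contra hlt
  have h2 := strictMono_stdCDF (not_le.1 hlt)
  have h3 : κ * (z + h - z) ≤ stdCDF (z + h) - stdCDF z := by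
    refine (convex_Icc z (z + h)).mul_sub_le_image_sub_of_le_deriv
      continuous_stdCDF.continuousOn
      (fun x _ => (hasDerivAt_stdCDF x).differentiableAt.differentiableWithinAt) (fun x hx => ?_)
      z ⟨le_rfl, by linarith⟩ (z + h) ⟨by linarith, le_rfl⟩ (by linarith)
    rw [(hasDerivAt_stdCDF x).deriv]
    have hx := interior_subset hx
    refine stdPDF_antitone ?_
    rw [abs_of_nonneg (a := |z| + 1) (by positivity), abs_le]
    constructor
    · linarith [hx.1, neg_abs_le z]
    · linarith [hx.2, le_abs_self z]
  have h4 := le_stdCDF_quantile h0 h1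
  rw [add_sub_cancel_left] at h3
  linarith

end Quantile

/-! ### The converse for output-only information densities -/

section Converse

variable {X Y : Type*} [Fintype Y]

-- Cut `(-∞, τ]` into unit windows going down from `τ`. Each has mass at most `B`, and the
-- exponential weight at least halves from one window to the next.
open Classical in
theorem prodExp_exp_truncated_le {n : ℕ} {q : Y → ℝ} (hq : q ∈ stdSimplex ℝ Y) {G : Y → ℝ} {A : ℝ}
    (hG : ∀ b, |G b| ≤ A) {B : ℝ}
    (hB : ∀ t, prodExp (fun _ : Fin n => q) (fun y => if ∑ i, G (y i) ≤ t then 1 else 0) -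
      prodExp (fun _ : Fin n => q) (fun y => if ∑ i, G (y i) ≤ t - 1 then 1 else 0) ≤ B) (τ : ℝ) :
    prodExp (fun _ : Fin n => q)
      (fun y => if ∑ i, G (y i) ≤ τ then Real.exp (∑ i, G (y i)) else 0) ≤
      2 * Real.exp τ * B := by
  have hp : ∀ _ : Fin n, q ∈ stdSimplex ℝ Y := fun _ => hq
  -- Finitely many windows suffice because `∑ G ≥ -(n * A)`; a value `g ≤ τ` lies in window number
  -- `⌊τ - g⌋₊`.
  set J := ⌊τ + n * A⌋₊ + 1
  have hB0 : 0 ≤ B := le_trans (sub_nonneg.2 (prodExp_mono hp fun y => by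
    split_ifs <;> first | rfl | exact zero_le_one | (exfalso; linarith))) (hB 0)
  calc _ ≤ prodExp (fun _ : Fin n => q) (fun y => ∑ j ∈ Finset.range J, Real.exp (τ - j) *
          ((if ∑ i, G (y i) ≤ τ - j then 1 else 0) -
            if ∑ i, G (y i) ≤ τ - j - 1 then 1 else 0)) := by
        refine prodExp_mono hp fun y => ?_
        set g := ∑ i, G (y i) with hg
        have hnn : ∀ j : ℕ, (0 : ℝ) ≤ Real.exp (τ - j) * ((if g ≤ τ - j then 1 else 0) -
            if g ≤ τ - j - 1 then 1 else 0) := fun j => by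
          refine mul_nonneg (Real.exp_pos _).le ?_
          split_ifs <;> first | norm_num; done | (exfalso; linarith)
        by_cases hgt : g ≤ τ
        · rw [if_pos hgt]
          have hgl : -(n * A) ≤ g := by
            have : |g| ≤ ∑ _i : Fin n, A :=
              (Finset.abs_sum_le_sum_abs _ _).trans (Finset.sum_le_sum fun i _ => hG _)
            simp only [Finset.sum_const, Finset.card_univ, Fintype.card_fin, nsmul_eq_mul] at this
            exact (abs_le.1 this).1
          have hj : ⌊τ - g⌋₊ ∈ Finset.range J := by
            rw [Finset.mem_range]
            exact Nat.lt_succ_of_le (Nat.floor_le_floor (by linarith))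
          refine le_trans ?_ (Finset.single_le_sum (fun j _ => hnn j) hj)
          have h1 := Nat.floor_le (sub_nonneg.2 hgt)
          have h2 := Nat.lt_floor_add_one (τ - g)
          rw [if_pos (by linarith), if_neg (by linarith), sub_zero, mul_one]
          exact Real.exp_le_exp.2 (by linarith)
        · rw [if_neg hgt]
          exact Finset.sum_nonneg fun j _ => hnn j
    _ ≤ ∑ j ∈ Finset.range J, Real.exp τ * (1 / 2) ^ j * B := by
        rw [prodExp_sum]
        refine Finset.sum_le_sum fun j _ => ?_
        rw [prodExp_const_mul, prodExp_sub]
        have he : Real.exp (τ - j) ≤ Real.exp τ * (1 / 2) ^ j := by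
          rw [sub_eq_add_neg, Real.exp_add]
          have h2 : Real.exp (-1) ≤ 1 / 2 := by
            rw [Real.exp_neg, inv_eq_one_div]
            have := Real.add_one_le_exp 1
            exact one_div_le_one_div_of_le (by norm_num) (by linarith)
          have h3 : Real.exp (-(j : ℝ)) = Real.exp (-1) ^ j := by
            rw [← Real.exp_nat_mul]; ring_nf
          rw [h3]
          gcongr
        exact (mul_le_mul_of_nonneg_left (hB _) (Real.exp_pos _).le).trans
          (mul_le_mul_of_nonneg_right he hB0)
    _ ≤ 2 * Real.exp τ * B := by
        rw [← Finset.sum_mul, ← Finset.mul_sum]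
        have := sum_geometric_two_le J
        calc _ ≤ Real.exp τ * 2 * B := by gcongr
          _ = _ := by ring

-- A unit window has width `1 / s` after normalisation and the normal distribution function is
-- 1-Lipschitz; the rest is two Berry-Esseen errors.
open Classical in
theorem prodExp_window_le {n : ℕ} {q : Y → ℝ} (hq : q ∈ stdSimplex ℝ Y) {G : Y → ℝ} {A : ℝ}
    (hA : 0 < A) (hG : ∀ b, |G b| ≤ A) {s : ℝ} (hs : 0 < s) (hs2 : s ^ 2 = n * finVar q G) (t : ℝ) :
    prodExp (fun _ : Fin n => q) (fun y => if ∑ i, G (y i) ≤ t then 1 else 0) -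
      prodExp (fun _ : Fin n => q) (fun y => if ∑ i, G (y i) ≤ t - 1 then 1 else 0) ≤
      (1 + 4 * A * berryConst) / s := by
  have hv : s ^ 2 = ∑ _i : Fin n, finVar q G := by simp [hs2]
  have h1 := abs_le.1 (berry_esseen (fun _ : Fin n => hq) hA hG hs hv t)
  have h2 := abs_le.1 (berry_esseen (fun _ : Fin n => hq) hA hG hs hv (t - 1))
  have h3 := stdCDF_sub_le (x := (t - 1 - ∑ _i : Fin n, finMean q G) / s)
    (y := (t - ∑ _i : Fin n, finMean q G) / s) (by gcongr; linarith)
  have h4 : (t - ∑ _i : Fin n, finMean q G) / s - (t - 1 - ∑ _i : Fin n, finMean q G) / s =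
    1 / s := by ring
  have h5 : (1 + 4 * A * berryConst) / s = 1 / s + 2 * (berryConst * (2 * A / s)) := by ring
  linarith [h1.2, h2.1]

open Classical in
/-- The information-spectrum converse with output distribution `q` and information density
dominated by `G`. -/
theorem one_le_avgError_add {W : X → Y → ℝ} (hW : IsChannel W) {n M : ℕ} (hM : 0 < M)
    (f : Fin M → Fin n → X) (φ : (Fin n → Y) → Fin M) {q G : Y → ℝ}
    (hqG : ∀ x b, W x b ≤ Real.exp (G b) * q b) (hq : ∀ b, 0 ≤ q b) {τ B : ℝ}
    (hB : ∀ m, prodExp (fun i => W (f m i)) (fun y => if ∑ i, G (y i) ≤ τ then 0 else 1) ≤ B) :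
    1 ≤ avgError W f φ + B + 1 / M * prodExp (fun _ : Fin n => q)
      (fun y => if ∑ i, G (y i) ≤ τ then Real.exp (∑ i, G (y i)) else 0) := by
  have hM' : (0 : ℝ) < M := by exact_mod_cast hM
  let T : (Fin n → Y) → ℝ := fun y =>
    (∏ i, q (y i)) * if ∑ i, G (y i) ≤ τ then Real.exp (∑ i, G (y i)) else 0
  have hT0 : ∀ y, 0 ≤ T y := fun y => mul_nonneg (Finset.prod_nonneg fun i _ => hq _) (by
    split_ifs
    · exact (Real.exp_pos _).le
    · rfl)
  have hdom : ∀ m (y : Fin n → Y), ∏ i, W (f m i) (y i) ≤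
      (∏ i, q (y i)) * Real.exp (∑ i, G (y i)) := fun m y => by
    rw [Real.exp_sum, mul_comm, ← Finset.prod_mul_distrib]
    exact Finset.prod_le_prod (fun i _ => (hW _).1 _) fun i _ => hqG _ _
  have hm : ∀ m, 1 ≤ ∑ y : Fin n → Y with φ y ≠ m, ∏ i, W (f m i) (y i) + B +
      ∑ y, if φ y = m then T y else 0 := fun m => by
    have h1 := prodExp_const (fun i => hW (f m i)) 1
    rw [← h1]
    refine le_trans ?_ (add_le_add_left (add_le_add_right (hB m) _) _)
    rw [Finset.sum_filter, prodExp, prodExp, ← Finset.sum_add_distrib, ← Finset.sum_add_distrib]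
    refine Finset.sum_le_sum fun y _ => ?_
    have hw0 : 0 ≤ ∏ i, W (f m i) (y i) := Finset.prod_nonneg fun i _ => (hW _).1 _
    by_cases hφ : φ y = m
    · by_cases hg : ∑ i, G (y i) ≤ τ
      · have := hdom m y
        simp only [hφ, T, if_pos hg, ne_eq, not_true_eq_false, if_false, if_true]
        linarith
      · have := hT0 y
        simp only [hφ, if_neg hg, ne_eq, not_true_eq_false, if_false, if_true]
        linarith
    · simp only [hφ, ne_eq, not_false_eq_true, if_true, if_false]
      split_ifs <;> linarith
  have hsum := Finset.sum_le_sum fun m (_ : m ∈ Finset.univ) => hm m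
  simp only [Finset.sum_add_distrib, Finset.sum_const, Finset.card_univ, Fintype.card_fin,
    nsmul_eq_mul, mul_one] at hsum
  -- The decoding regions partition the outputs, so each `T y` is counted exactly once.
  rw [Finset.sum_comm (f := fun m y => if φ y = m then T y else 0)] at hsum
  simp only [Finset.sum_ite_eq, Finset.mem_univ, if_true] at hsum
  have hsT : ∑ y, T y = prodExp (fun _ : Fin n => q)
      (fun y => if ∑ i, G (y i) ≤ τ then Real.exp (∑ i, G (y i)) else 0) := rfl
  rw [hsT] at hsum
  have := mul_le_mul_of_nonneg_left hsum (one_div_pos.2 hM').le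
  rw [mul_add, mul_add, one_div_mul_cancel hM'.ne', ← mul_assoc (1 / (M : ℝ)) M B,
    one_div_mul_cancel hM'.ne', one_mul] at this
  exact this

/-- Converse with bounded error term: the information density `∑ i, G (y i)` depends on the output
alone, so that its fluctuations under `q` improve the usual third-order term. -/
theorem exists_log_card_le {W : X → Y → ℝ} (hW : IsChannel W) {ε A : ℝ} (h0 : 0 < ε) (h1 : ε < 1)
    (hA : 0 < A) :
    ∃ K : ℝ, ∀ (n M : ℕ) (f : Fin M → Fin n → X) (φ : (Fin n → Y) → Fin M) (q G : Y → ℝ)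
      (μ v : ℝ), 0 < M → q ∈ stdSimplex ℝ Y → (∀ b, |G b| ≤ A) →
      (∀ x b, W x b ≤ Real.exp (G b) * q b) →
      (∀ m, ∑ i, finMean (W (f m i)) G = μ) → (∀ m, ∑ i, finVar (W (f m i)) G = v) →
      v ≤ 2 * (n * finVar q G) → avgError W f φ ≤ ε →
      Real.log M ≤ μ + Real.sqrt v * stdNormalQuantile ε + K := by
  classical
  have hbc := berryConst_pos
  set z := stdNormalQuantile ε
  set κ := stdPDF (|z| + 1) with hκ
  have hκ0 : 0 < κ := stdPDF_pos _
  -- All error terms add up to `c / s`. With `s₀ = c / κ` they equal `κ * (s₀ / s)`, and `s₀ / s ≤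
  -- 1` when `s ≥ s₀`, as `le_quantile_add` requires. The radius `r` makes Chebyshev's bound at most
  -- `(1 - ε) / 2` when `s < s₀`.
  set c := 2 * A * berryConst + 4 * (1 + 4 * A * berryConst) with hc
  have hc0 : 0 < c := by positivity
  set s₀ := c / κ with hs₀
  have hs₀0 : 0 < s₀ := by positivity
  set r := s₀ * (2 / (1 - ε)) with hr
  have hε : 0 < 1 - ε := by linarith
  have hr0 : 0 < r := by positivity
  have hlog : 0 ≤ Real.log (2 / (1 - ε)) := Real.log_nonneg (by
    rw [le_div_iff₀ hε]; linarith)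
  refine ⟨s₀ + s₀ * |z| + r + Real.log (2 / (1 - ε)), ?_⟩
  intro n M f φ q G μ v hM hq hG hqG hμ hv hvq herr
  have hM' : (0 : ℝ) < M := by exact_mod_cast hM
  set s := Real.sqrt v with hs
  have hv0 : 0 ≤ v := by
    rw [← hv ⟨0, hM⟩]
    exact Finset.sum_nonneg fun i _ => finVar_nonneg (hW _) G
  have hsv : s ^ 2 = v := Real.sq_sqrt hv0
  rcases le_or_gt s₀ s with hss | hss
  · have hs0 : 0 < s := hs₀0.trans_le hss
    set s' := Real.sqrt (n * finVar q G) with hs'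
    have hnq : 0 ≤ n * finVar q G := mul_nonneg (Nat.cast_nonneg _) (finVar_nonneg hq G)
    have hs'2 : s' ^ 2 = n * finVar q G := Real.sq_sqrt hnq
    have hs's : s ≤ 2 * s' := by
      refine abs_le_of_sq_le_sq' ?_ (by positivity) |>.2
      nlinarith
    have hs'0 : 0 < s' := by linarith
    have hP : ∀ m, prodExp (fun i => W (f m i))
        (fun y => if ∑ i, G (y i) ≤ Real.log M then 0 else 1) ≤
        1 - stdCDF ((Real.log M - μ) / s) + berryConst * (2 * A / s) := fun m => by
      have h := (abs_le.1 (berry_esseen (fun i => hW (f m i)) hA hG hs0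
        (hsv.trans (hv m).symm) (Real.log M))).1
      rw [hμ] at h
      have e : (fun y : Fin n → Y => if ∑ i, G (y i) ≤ Real.log M then (0 : ℝ) else 1) =
          fun y => 1 - if ∑ i, G (y i) ≤ Real.log M then (1 : ℝ) else 0 := by
        funext y; split_ifs <;> norm_num
      rw [e, prodExp_sub, prodExp_const fun i => hW (f m i)]
      linarith
    have h2 := one_le_avgError_add hW hM f φ hqG hq.1 hP
    have h3 := prodExp_exp_truncated_le hq hG (prodExp_window_le hq hA hG hs'0 hs'2) (Real.log M)
    rw [Real.exp_log hM'] at h3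
    have h4 : 1 / (M : ℝ) * (2 * M * ((1 + 4 * A * berryConst) / s')) ≤
        4 * (1 + 4 * A * berryConst) / s := by
      have : 1 / (M : ℝ) * (2 * M * ((1 + 4 * A * berryConst) / s')) =
        4 * (1 + 4 * A * berryConst) / (2 * s') := by field_simp; ring
      rw [this]
      exact div_le_div_of_nonneg_left (by positivity) hs0 hs's
    have h5 := mul_le_mul_of_nonneg_left h3 (one_div_pos.2 hM').le
    have h6 : stdCDF ((Real.log M - μ) / s) ≤ ε + κ * (s₀ / s) := by
      have e : κ * (s₀ / s) = berryConst * (2 * A / s) + 4 * (1 + 4 * A * berryConst) / s := by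
        rw [hs₀, hc]; field_simp
      rw [e]
      linarith
    have h7 := le_quantile_add h0 h1 (h := s₀ / s) (by positivity) (div_le_one_of_le₀ hss hs0.le) h6
    rw [div_le_iff₀ hs0] at h7
    have h8 : (z + s₀ / s) * s = s * z + s₀ := by field_simp
    rw [h8] at h7
    have : 0 ≤ s₀ * |z| := by positivity
    linarith
  -- For bounded variance no normal approximation is needed: Chebyshev gives `log M ≤ μ + O(1)`, and
  -- `s * z` is itself bounded by `s₀ * |z|`.
  · have hP : ∀ m, prodExp (fun i => W (f m i))
        (fun y => if ∑ i, G (y i) ≤ μ + r then 0 else 1) ≤ (1 - ε) / 2 := fun m => by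
      have h := chebyshev_prodExp (fun i => hW (f m i)) G hr0
      rw [hμ, hv] at h
      refine h.trans ?_
      rw [div_le_iff₀ (by positivity), ← hsv]
      have : (1 - ε) / 2 * r ^ 2 = s₀ ^ 2 * (2 / (1 - ε)) := by rw [hr]; field_simp
      rw [this]
      have h9 : 1 ≤ 2 / (1 - ε) := by rw [le_div_iff₀ hε]; linarith
      have h10 : s ^ 2 ≤ s₀ ^ 2 := by gcongr
      nlinarith [sq_nonneg s₀]
    have h2 := one_le_avgError_add hW hM f φ hqG hq.1 hP
    have h3 : prodExp (fun _ : Fin n => q)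
        (fun y => if ∑ i, G (y i) ≤ μ + r then Real.exp (∑ i, G (y i)) else 0) ≤
        Real.exp (μ + r) := by
      rw [← prodExp_const (fun _ : Fin n => hq) (Real.exp (μ + r))]
      refine prodExp_mono (fun _ => hq) fun y => ?_
      split_ifs with h
      · exact Real.exp_le_exp.2 h
      · exact (Real.exp_pos _).le
    have h4 := mul_le_mul_of_nonneg_left h3 (one_div_pos.2 hM').le
    have h5 : (1 - ε) / 2 ≤ Real.exp (μ + r) / M := by
      rw [div_eq_mul_one_div (Real.exp _), mul_comm (Real.exp _)]
      linarith
    have h6 : (M : ℝ) ≤ 2 / (1 - ε) * Real.exp (μ + r) := by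
      rw [le_div_iff₀ hM'] at h5
      rw [div_mul_eq_mul_div, le_div_iff₀ hε]
      linarith
    have h7 := Real.log_le_log hM' h6
    rw [Real.log_mul (by positivity) (Real.exp_pos _).ne', Real.log_exp] at h7
    have h8 : -(s₀ * |z|) ≤ s * z := by
      have : |s * z| ≤ s₀ * |z| := by
        rw [abs_mul, abs_of_nonneg (Real.sqrt_nonneg v)]
        gcongr
      exact (abs_le.1 this).1
    linarith

end Converse

/-! ### A Hoffman-type bound for linear forms on the orthant -/

section Cone

/-- A linear form that is nonnegative on the nonnegative solutions of a homogeneous linear system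
is bounded below on the nonnegative orthant by a multiple of the residual of the system. -/
theorem exists_neg_mul_norm_le_sum {X E : Type*} [Fintype X] [NormedAddCommGroup E]
    [NormedSpace ℝ E] (a : X → E) (b : X → ℝ)
    (h : ∀ P : X → ℝ, (∀ x, 0 ≤ P x) → ∑ x, P x • a x = 0 → 0 ≤ ∑ x, P x * b x) :
    ∃ L : ℝ, 0 ≤ L ∧ ∀ P : X → ℝ, (∀ x, 0 ≤ P x) →
      -(L * ‖∑ x, P x • a x‖) ≤ ∑ x, P x * b x := by
  classical
  have hS : ∀ (S : Finset X) (P : X → ℝ), (∀ x ∈ S, 0 ≤ P x) → ∑ x ∈ S, P x • a x = 0 →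
      0 ≤ ∑ x ∈ S, P x * b x := fun S P hP h0 => by
    have := h (fun x => if x ∈ S then P x else 0)
      (fun x => by split_ifs with hx; exacts [hP x hx, le_rfl])
      (by simpa [ite_smul, Finset.sum_ite_mem] using h0)
    simpa [ite_mul, Finset.sum_ite_mem] using this
  suffices H : ∀ (k : ℕ) (S : Finset X), S.card = k → ∃ L : ℝ, 0 ≤ L ∧ ∀ P : X → ℝ,
      (∀ x ∈ S, 0 ≤ P x) → -(L * ‖∑ x ∈ S, P x • a x‖) ≤ ∑ x ∈ S, P x * b x by
    obtain ⟨L, hL, hL'⟩ := H _ Finset.univ rfl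
    exact ⟨L, hL, fun P hP => hL' P fun x _ => hP x⟩
  intro k
  induction k with
  | zero =>
    intro S hk
    rw [Finset.card_eq_zero] at hk
    subst hk
    exact ⟨0, le_rfl, fun P _ => by simp⟩
  | succ k ih =>
    intro S hk
    -- For independent vectors the coefficients are controlled by the residual. Otherwise, as in
    -- Carathéodory's theorem, a linear relation is used to remove one element of `S` and the
    -- induction hypothesis applies.
    by_cases hli : LinearIndepOn ℝ a (S : Set X)
    · let T : (S → ℝ) →ₗ[ℝ] E := Fintype.linearCombination ℝ (fun x : S => a x)
      have hinj : LinearMap.ker T = ⊥ :=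
        LinearMap.ker_eq_bot.2 (LinearIndependent.fintypeLinearCombination_injective hli)
      obtain ⟨K, -, hK⟩ := T.exists_antilipschitzWith hinj
      refine ⟨(∑ x ∈ S, |b x|) * K, by positivity, fun P _ => ?_⟩
      let p : S → ℝ := fun x => P x
      have h1 : ‖p‖ ≤ K * ‖T p‖ := by
        have := hK.le_mul_dist p 0
        simpa using this
      have h2 : T p = ∑ x ∈ S, P x • a x := by
        simp only [T, p, Fintype.linearCombination_apply]
        exact Finset.sum_coe_sort S (fun x => P x • a x)
      have h3 : |∑ x ∈ S, P x * b x| ≤ (∑ x ∈ S, |b x|) * ‖p‖ := by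
        rw [Finset.sum_mul]
        refine (Finset.abs_sum_le_sum_abs _ _).trans (Finset.sum_le_sum fun x hx => ?_)
        rw [abs_mul, mul_comm]
        exact mul_le_mul_of_nonneg_left (norm_le_pi_norm p ⟨x, hx⟩) (abs_nonneg _)
      have h4 : (∑ x ∈ S, |b x|) * ‖p‖ ≤ (∑ x ∈ S, |b x|) * (K * ‖T p‖) := by gcongr
      rw [h2, ← mul_assoc] at h4
      linarith [neg_abs_le (∑ x ∈ S, P x * b x)]
    · rw [linearIndepOn_finset_iff] at hli
      push Not at hli
      obtain ⟨g, hg0, x₁, hx₁, hgx₁⟩ := hli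
      -- The relation must have a positive coordinate and a nonnegative `b`-value. If `g` has no
      -- positive coordinate, `-g` is a nonnegative solution, so the hypothesis on the form fixes
      -- its sign.
      have aux : ∀ g : X → ℝ, ∑ x ∈ S, g x • a x = 0 → (∃ x ∈ S, g x ≠ 0) →
          0 ≤ ∑ x ∈ S, g x * b x → ∃ r : X → ℝ, ∑ x ∈ S, r x • a x = 0 ∧
            (∃ x ∈ S, 0 < r x) ∧ 0 ≤ ∑ x ∈ S, r x * b x := by
        intro g hg hne hb
        by_cases hpos : ∃ x ∈ S, 0 < g x
        · exact ⟨g, hg, hpos, hb⟩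
        · push Not at hpos
          obtain ⟨x, hx, hgx⟩ := hne
          have h0 : ∑ x ∈ S, (-g x) • a x = 0 := by simp [hg]
          exact ⟨fun x => -g x, h0,
            ⟨x, hx, neg_pos.2 (lt_of_le_of_ne (hpos x hx) hgx)⟩,
            hS S _ (fun x hx => neg_nonneg.2 (hpos x hx)) h0⟩
      obtain ⟨r, hr, hrpos, hrb⟩ : ∃ r : X → ℝ, ∑ x ∈ S, r x • a x = 0 ∧
            (∃ x ∈ S, 0 < r x) ∧ 0 ≤ ∑ x ∈ S, r x * b x := by
        rcases le_total 0 (∑ x ∈ S, g x * b x) with hb | hb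
        · exact aux g hg0 ⟨x₁, hx₁, hgx₁⟩ hb
        · exact aux (fun x => -g x) (by simp [hg0]) ⟨x₁, hx₁, neg_ne_zero.2 hgx₁⟩
            (by simpa using hb)
      have hch : ∀ x, ∃ L : ℝ, 0 ≤ L ∧ (x ∈ S → ∀ P : X → ℝ, (∀ z ∈ S.erase x, 0 ≤ P z) →
          -(L * ‖∑ z ∈ S.erase x, P z • a z‖) ≤ ∑ z ∈ S.erase x, P z * b z) := fun x => by
        by_cases hx : x ∈ S
        · obtain ⟨L, hL, hL'⟩ := ih (S.erase x) (by rw [Finset.card_erase_of_mem hx, hk]; rfl)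
          exact ⟨L, hL, fun _ => hL'⟩
        · exact ⟨0, le_rfl, fun hx' => absurd hx' hx⟩
      choose L hL0 hL using hch
      refine ⟨∑ x ∈ S, L x, Finset.sum_nonneg fun x _ => hL0 x, fun P hP => ?_⟩
      have hne : (S.filter fun x => 0 < r x).Nonempty := by
        obtain ⟨x, hx, hrx⟩ := hrpos
        exact ⟨x, Finset.mem_filter.2 ⟨hx, hrx⟩⟩
      -- The ratio test of the simplex method: subtracting `t * r` with the minimal ratio `t` makes
      -- coordinate `x₀` vanish and keeps the others nonnegative. The residual is unchanged and the
      -- form does not increase.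
      obtain ⟨x₀, hx₀, hmin⟩ := Finset.exists_min_image _ (fun x => P x / r x) hne
      rw [Finset.mem_filter] at hx₀
      obtain ⟨hx₀S, hrx₀⟩ := hx₀
      set t := P x₀ / r x₀ with ht
      have ht0 : 0 ≤ t := div_nonneg (hP _ hx₀S) hrx₀.le
      have hzero : P x₀ - t * r x₀ = 0 := by rw [ht]; field_simp; ring
      have hnn : ∀ z ∈ S.erase x₀, 0 ≤ P z - t * r z := fun z hz => by
        have hzS := Finset.mem_of_mem_erase hz
        rcases le_or_gt (r z) 0 with hrz | hrz
        · nlinarith [hP z hzS]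
        · have := hmin z (Finset.mem_filter.2 ⟨hzS, hrz⟩)
          rw [le_div_iff₀ hrz] at this
          linarith
      have h1 := hL x₀ hx₀S (fun z => P z - t * r z) hnn
      have e1 : ∑ z ∈ S.erase x₀, (P z - t * r z) • a z = ∑ z ∈ S, P z • a z := by
        rw [Finset.sum_erase _ (by rw [hzero, zero_smul])]
        simp only [sub_smul, Finset.sum_sub_distrib, mul_smul, ← Finset.smul_sum, hr, smul_zero,
          sub_zero]
      have e2 : ∑ z ∈ S.erase x₀, (P z - t * r z) * b z =
          ∑ z ∈ S, P z * b z - t * ∑ z ∈ S, r z * b z := by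
        rw [Finset.sum_erase _ (by rw [hzero, zero_mul])]
        simp only [sub_mul, Finset.sum_sub_distrib, mul_assoc, ← Finset.mul_sum]
      rw [e1, e2] at h1
      have h2 : L x₀ * ‖∑ z ∈ S, P z • a z‖ ≤ (∑ x ∈ S, L x) * ‖∑ z ∈ S, P z • a z‖ :=
        mul_le_mul_of_nonneg_right (Finset.single_le_sum (fun x _ => hL0 x) hx₀S) (norm_nonneg _)
      have h3 := mul_nonneg ht0 hrb
      linarith

end Cone

/-! ### A pointwise quadratic lower bound for relative entropy -/

section Divergence

/-- A termwise Pinsker inequality. With `u = √q`, `v = √r`, the bound `log x ≤ x - 1` at `v / u`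
leaves the Hellinger term `(u - v)²`, which dominates `(q - r)² / 4` since `u + v ≤ 2`. -/
theorem sub_add_sq_le_mul_log {q r : ℝ} (hq : 0 < q) (hr : 0 < r) (hq1 : q ≤ 1) (hr1 : r ≤ 1) :
    q - r + (q - r) ^ 2 / 4 ≤ q * Real.log (q / r) := by
  have hsq := Real.sqrt_pos.2 hq
  have hsr := Real.sqrt_pos.2 hr
  have hsq1 := Real.sqrt_le_one.2 hq1
  have hsr1 := Real.sqrt_le_one.2 hr1
  have hq2 := Real.sq_sqrt hq.le
  have hr2 := Real.sq_sqrt hr.le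
  set u := Real.sqrt q
  set v := Real.sqrt r
  have h1 : Real.log (q / r) = -(2 * Real.log (v / u)) := by
    rw [← hq2, ← hr2, ← div_pow, Real.log_pow, ← inv_div, Real.log_inv]
    push_cast; ring
  have h2 := Real.log_le_sub_one_of_pos (div_pos hsr hsq)
  have h3 : u ^ 2 * (v / u) = u * v := by field_simp
  have h4 : (u + v) ^ 2 ≤ 4 := by nlinarith
  rw [h1, ← hq2, ← hr2]
  have h5 : (u ^ 2 - v ^ 2) ^ 2 = (u - v) ^ 2 * (u + v) ^ 2 := by ring
  have h6 : (u ^ 2 - v ^ 2) ^ 2 / 4 ≤ (u - v) ^ 2 := by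
    rw [h5]; nlinarith [sq_nonneg (u - v)]
  nlinarith [mul_le_mul_of_nonneg_left h2 (sq_nonneg u)]

end Divergence

/-! ### Capacity of singular channels and its optimality conditions -/

section Capacity

variable {X Y : Type*}

/-- For a singular channel, `w y` is the common value of the positive entries of column `y`, and
`0` if there is none. -/
def IsColumnWeight (W : X → Y → ℝ) (w : Y → ℝ) : Prop :=
  (∀ x y, W x y = 0 ∨ W x y = w y) ∧ ∀ y, w y = 0 ∨ ∃ x, W x y = w y ∧ 0 < w y

theorem exists_isColumnWeight [Fintype Y] {W : X → Y → ℝ} (hW : IsChannel W) (hs : IsSingularChannel W) :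
    ∃ w, IsColumnWeight W w := by
  have : ∀ y, ∃ c, (∀ x, W x y = 0 ∨ W x y = c) ∧ (c = 0 ∨ ∃ x, W x y = c ∧ 0 < c) := fun y => by
    by_cases h : ∃ x, 0 < W x y
    · obtain ⟨x, hx⟩ := h
      refine ⟨W x y, fun z => ?_, Or.inr ⟨x, rfl, hx⟩⟩
      rcases ((hW z).1 y).eq_or_lt with h0 | h0
      · exact Or.inl h0.symm
      · exact Or.inr (hs z y x (mul_pos h0 hx))
    · push Not at h
      exact ⟨0, fun x => Or.inl (le_antisymm (h x) ((hW x).1 y)), Or.inl rfl⟩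
  choose w h1 h2 using this
  exact ⟨w, fun x y => h1 y x, h2⟩

theorem IsColumnWeight.nonneg {W : X → Y → ℝ} {w : Y → ℝ} (hw : IsColumnWeight W w) (y : Y) :
    0 ≤ w y := by
  rcases hw.2 y with h | ⟨x, -, h⟩
  exacts [h.ge, h.le]

theorem IsColumnWeight.eq_zero {W : X → Y → ℝ} {w : Y → ℝ} (hw : IsColumnWeight W w) {y : Y}
    (h : w y = 0) (x : X) : W x y = 0 := by
  rcases hw.1 x y with h' | h'
  exacts [h', h'.trans h]

/-- The information density `log (w / q)` of a singular channel, relative to the output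
distribution `q`. -/
noncomputable def infoDensity (w q : Y → ℝ) (y : Y) : ℝ := Real.log (w y / q y)

theorem IsColumnWeight.finMean_log [Fintype Y] {W : X → Y → ℝ} {w : Y → ℝ} (hw : IsColumnWeight W w)
    (q : Y → ℝ) (x : X) :
    ∑ y, W x y * Real.log (W x y / q y) = finMean (W x) (infoDensity w q) := by
  refine Finset.sum_congr rfl fun y _ => ?_
  rcases hw.1 x y with h | h
  · rw [h, zero_mul, zero_mul]
  · rw [infoDensity, h]

theorem IsColumnWeight.outputDist_eq_zero [Fintype X] {W : X → Y → ℝ} {w : Y → ℝ} (hw : IsColumnWeight W w)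
    {y : Y} (h : w y = 0) (P : X → ℝ) : outputDist W P y = 0 := by
  simp [outputDist, hw.eq_zero h]

variable [Fintype X] [Fintype Y]

theorem outputDist_mem {W : X → Y → ℝ} (hW : IsChannel W) {P : X → ℝ} (hP : P ∈ stdSimplex ℝ X) :
    outputDist W P ∈ stdSimplex ℝ Y := by
  refine ⟨fun y => Finset.sum_nonneg fun x _ => mul_nonneg (hP.1 x) ((hW x).1 y), ?_⟩
  simp only [outputDist]
  rw [Finset.sum_comm]
  simp only [← Finset.mul_sum, (hW _).2, mul_one, hP.2]

theorem stdSimplex_le_one {p : Y → ℝ} (hp : p ∈ stdSimplex ℝ Y) (y : Y) : p y ≤ 1 := by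
  rw [← hp.2]
  exact Finset.single_le_sum (fun i _ => hp.1 i) (Finset.mem_univ y)

theorem sum_mul_finMean (W : X → Y → ℝ) (P : X → ℝ) (G : Y → ℝ) :
    ∑ x, P x * finMean (W x) G = finMean (outputDist W P) G := by
  simp only [finMean, outputDist, Finset.mul_sum, Finset.sum_mul]
  rw [Finset.sum_comm]
  exact Finset.sum_congr rfl fun y _ => Finset.sum_congr rfl fun x _ => by ring

theorem IsColumnWeight.mutualInfo_eq {W : X → Y → ℝ} {w : Y → ℝ} (hw : IsColumnWeight W w)
    (P : X → ℝ) :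
    mutualInfo W P = finMean (outputDist W P) (infoDensity w (outputDist W P)) := by
  rw [← sum_mul_finMean, mutualInfo]
  refine Finset.sum_congr rfl fun x _ => ?_
  rw [← hw.finMean_log, Finset.mul_sum]
  exact Finset.sum_congr rfl fun y _ => by ring

/-- Singularity splits the mutual information into a part linear in `P` and the output entropy. -/
theorem IsColumnWeight.mutualInfo_continuous {W : X → Y → ℝ} {w : Y → ℝ}
    (hw : IsColumnWeight W w) : Continuous (mutualInfo W) := by
  have e : mutualInfo W = fun P => ∑ y, (outputDist W P y * Real.log (w y) +
      Real.negMulLog (outputDist W P y)) := by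
    funext P
    rw [hw.mutualInfo_eq, finMean]
    refine Finset.sum_congr rfl fun y _ => ?_
    rcases eq_or_ne (outputDist W P y) 0 with h | h
    · simp [h]
    · have hwy : w y ≠ 0 := fun h' => h (hw.outputDist_eq_zero h' P)
      rw [infoDensity, Real.log_div hwy h, Real.negMulLog]
      ring
  have hc : ∀ y, Continuous fun P : X → ℝ => outputDist W P y := fun y => by
    unfold outputDist; fun_prop
  rw [e]
  exact continuous_finsetSum _ fun y _ =>
    ((hc y).mul continuous_const).add (Real.continuous_negMulLog.comp (hc y))

theorem IsColumnWeight.mutualInfo_le_capacity {W : X → Y → ℝ} {w : Y → ℝ}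
    (hw : IsColumnWeight W w) {P : X → ℝ} (hP : P ∈ stdSimplex ℝ X) :
    mutualInfo W P ≤ capacity W :=
  le_csSup ((isCompact_stdSimplex ℝ X).image hw.mutualInfo_continuous).bddAbove
    (mem_image_of_mem _ hP)

theorem IsColumnWeight.capacityAchieving_nonempty [Nonempty X] {W : X → Y → ℝ} {w : Y → ℝ}
    (hw : IsColumnWeight W w) : (capacityAchieving W).Nonempty := by
  classical
  have hne : (stdSimplex ℝ X).Nonempty :=
    ⟨_, single_mem_stdSimplex ℝ (Classical.arbitrary X)⟩
  obtain ⟨P, hP, hP'⟩ := ((isCompact_stdSimplex ℝ X).image hw.mutualInfo_continuous).sSup_mem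
    (hne.image _)
  exact ⟨P, hP, hP'⟩

section KKT

variable {W : X → Y → ℝ} {w : Y → ℝ} {P : X → ℝ}

/-- Moving `P` by `t` towards the point mass at `x` cannot raise the mutual information above
capacity. By Gibbs' inequality the part averaged over the old output is still at least the capacity,
so the part averaged over `W x` cannot exceed it. -/
theorem finMean_infoDensity_perturbed_le (hW : IsChannel W) (hw : IsColumnWeight W w)
    (hP : P ∈ capacityAchieving W) (x : X) {t : ℝ} (ht0 : 0 < t) (ht1 : t < 1) :
    finMean (W x) (infoDensity w fun y => (1 - t) * outputDist W P y + t * W x y) ≤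
      capacity W := by
  classical
  let Pt : X → ℝ := fun z => (1 - t) * P z + t * (Pi.single x 1 : X → ℝ) z
  have hPt : Pt ∈ stdSimplex ℝ X :=
    (convex_stdSimplex ℝ X) hP.1 (single_mem_stdSimplex ℝ x) (by linarith) ht0.le (by ring)
  set q := outputDist W P with hq
  let qt : Y → ℝ := fun y => (1 - t) * q y + t * W x y
  have hqt : outputDist W Pt = qt := by
    funext y
    simp only [outputDist, Pt, qt, hq, add_mul, Finset.sum_add_distrib, mul_assoc,
      ← Finset.mul_sum]
    congr 2
    simp [Pi.single_apply]
  have hqm : q ∈ stdSimplex ℝ Y := outputDist_mem hW hP.1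
  have hqtm : qt ∈ stdSimplex ℝ Y := hqt ▸ outputDist_mem hW hPt
  have h1 := hw.mutualInfo_le_capacity hPt
  rw [hw.mutualInfo_eq, hqt] at h1
  have h2 : finMean qt (infoDensity w qt) =
      (1 - t) * finMean q (infoDensity w qt) + t * finMean (W x) (infoDensity w qt) := by
    simp only [finMean, Finset.mul_sum, ← Finset.sum_add_distrib]
    exact Finset.sum_congr rfl fun y _ => by simp only [qt]; ring
  have h3 : capacity W ≤ finMean q (infoDensity w qt) := by
    rw [← hP.2, hw.mutualInfo_eq, ← hq]
    have : ∀ y, q y * infoDensity w q y + (q y - qt y) ≤ q y * infoDensity w qt y := fun y => by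
      rcases (hqm.1 y).eq_or_lt with h0 | h0
      · rw [← h0]
        linarith [hqtm.1 y]
      · have hwy : w y ≠ 0 := fun h' => h0.ne' (hw.outputDist_eq_zero h' P)
        have hqt0 : 0 < qt y :=
          add_pos_of_pos_of_nonneg (mul_pos (by linarith) h0) (mul_nonneg ht0.le ((hW x).1 y))
        have hl := Real.log_le_sub_one_of_pos (div_pos hqt0 h0)
        rw [Real.log_div hqt0.ne' h0.ne'] at hl
        have := mul_le_mul_of_nonneg_left hl h0.le
        rw [mul_sub (q y) (qt y / q y), mul_div_cancel₀ _ h0.ne'] at this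
        rw [infoDensity, infoDensity, Real.log_div hwy h0.ne', Real.log_div hwy hqt0.ne']
        linarith
    have hs := Finset.sum_le_sum fun y (_ : y ∈ Finset.univ) => this y
    rw [Finset.sum_add_distrib, Finset.sum_sub_distrib, hqm.2, hqtm.2] at hs
    simpa [finMean] using hs
  rw [h2] at h1
  have h4 := mul_le_mul_of_nonneg_left h3 (by linarith : (0 : ℝ) ≤ 1 - t)
  have h5 : t * finMean (W x) (infoDensity w qt) ≤ t * capacity W := by linarith
  exact le_of_mul_le_mul_left h5 ht0

/-- If an attainable letter `y` had output probability zero, moving mass `t` to an input reaching it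
would produce a term of order `-log t`, violating the perturbed bound for small `t`. -/
theorem outputDist_pos (hW : IsChannel W) (hw : IsColumnWeight W w)
    (hP : P ∈ capacityAchieving W) {y : Y} (hy : 0 < w y) : 0 < outputDist W P y := by
  have hqm : outputDist W P ∈ stdSimplex ℝ Y := outputDist_mem hW hP.1
  refine lt_of_le_of_ne (hqm.1 y) fun hq0 => ?_
  obtain ⟨x, hx, -⟩ := (hw.2 y).resolve_left hy.ne'
  set B := ∑ b, |W x b * Real.log (w b)| with hB
  set D := |capacity W| + B + 1 with hD
  have hD0 : 0 < D := by positivity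
  -- Chosen so that the term of `y` equals `D` exactly; the other terms total at least `-B`, and `D
  -- - B > capacity W`.
  set t := Real.exp (-(D / w y)) with ht
  have ht0 : 0 < t := Real.exp_pos _
  have ht1 : t < 1 := Real.exp_lt_one_iff.2 (neg_neg_of_pos (div_pos hD0 hy))
  have h := finMean_infoDensity_perturbed_le hW hw hP x ht0 ht1
  set qt : Y → ℝ := fun b => (1 - t) * outputDist W P b + t * W x b with hqt
  have hterm : ∀ b, -|W x b * Real.log (w b)| ≤ W x b * infoDensity w qt b := fun b => by
    rcases hw.1 x b with h0 | h0
    · simp [h0]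
    · rcases (hw.nonneg b).eq_or_lt with hb | hb
      · simp [h0, ← hb]
      · have hq1 : qt b ≤ 1 := by
          have h1 := stdSimplex_le_one hqm b
          have h2 := stdSimplex_le_one (hW x) b
          simp only [hqt]; nlinarith
        have hq0 : 0 < qt b :=
          add_pos_of_nonneg_of_pos (mul_nonneg (by linarith) (hqm.1 b))
            (mul_pos ht0 (h0 ▸ hb))
        have hl := Real.log_nonpos hq0.le hq1
        rw [infoDensity, Real.log_div hb.ne' hq0.ne', mul_sub]
        have : W x b * Real.log (qt b) ≤ 0 := mul_nonpos_of_nonneg_of_nonpos ((hW x).1 b) hl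
        linarith [neg_abs_le (W x b * Real.log (w b))]
  have hy' : W x y * infoDensity w qt y = D := by
    have : qt y = t * w y := by simp only [hqt, ← hq0, hx]; ring
    rw [infoDensity, this, Real.log_div hy.ne' (by positivity), Real.log_mul ht0.ne' hy.ne', ht,
      Real.log_exp, hx]
    field_simp
    ring
  classical
  rw [finMean, ← Finset.add_sum_erase _ _ (Finset.mem_univ y), hy'] at h
  have h2 : -B ≤ ∑ b ∈ Finset.univ.erase y, W x b * infoDensity w qt b := by
    calc -B ≤ ∑ b ∈ Finset.univ.erase y, -|W x b * Real.log (w b)| := by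
          rw [hB, Finset.sum_neg_distrib]
          exact neg_le_neg (Finset.sum_le_sum_of_subset_of_nonneg (Finset.erase_subset _ _)
            fun b _ _ => abs_nonneg _)
      _ ≤ _ := Finset.sum_le_sum fun b _ => hterm b
  linarith [le_abs_self (capacity W)]

/-- The Kuhn-Tucker condition: let `t → 0` in the perturbed bound. Positivity of the output
distribution makes the limit legitimate. -/
theorem finMean_infoDensity_le_capacity (hW : IsChannel W) (hw : IsColumnWeight W w)
    (hP : P ∈ capacityAchieving W) (x : X) :
    finMean (W x) (infoDensity w (outputDist W P)) ≤ capacity W := by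
  have hc : ContinuousAt (fun t : ℝ =>
      finMean (W x) (infoDensity w fun y => (1 - t) * outputDist W P y + t * W x y)) 0 := by
    unfold finMean infoDensity
    refine tendsto_finsetSum _ fun y _ => ?_
    rcases (hw.nonneg y).eq_or_lt with hy | hy
    · simp only [hw.eq_zero hy.symm x, zero_mul]
      exact tendsto_const_nhds
    · have hq := outputDist_pos hW hw hP hy
      have h1 : ContinuousAt (fun t : ℝ => (1 - t) * outputDist W P y + t * W x y) 0 := by fun_prop
      have h2 : (1 - (0 : ℝ)) * outputDist W P y + 0 * W x y ≠ 0 := by simpa using hq.ne'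
      exact (continuousAt_const.mul
        ((continuousAt_const.div h1 h2).log (div_ne_zero hy.ne' h2)))
  have ht : Filter.Tendsto (fun t : ℝ =>
      finMean (W x) (infoDensity w fun y => (1 - t) * outputDist W P y + t * W x y))
      (nhdsWithin 0 (Ioi 0)) (nhds (finMean (W x) (infoDensity w (outputDist W P)))) := by
    have := hc.tendsto.mono_left (nhdsWithin_le_nhds (s := Ioi (0 : ℝ)))
    simpa using this
  refine le_of_tendsto ht ?_
  filter_upwards [Ioo_mem_nhdsGT (zero_lt_one' ℝ)] with t ht
  exact finMean_infoDensity_perturbed_le hW hw hP x ht.1 ht.2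

end KKT

end Capacity

/-! ### Stability of the variance -/

section Variance

variable {Y : Type*} [Fintype Y]

theorem finVar_le {p : Y → ℝ} (hp : p ∈ stdSimplex ℝ Y) (G : Y → ℝ) (c : ℝ) :
    finVar p G ≤ ∑ b, p b * (G b - c) ^ 2 := by
  have h : ∑ b, p b * (G b - c) ^ 2 = finVar p G + (finMean p G - c) ^ 2 := by
    have e : ∀ b, p b * (G b - c) ^ 2 = p b * (G b - finMean p G) ^ 2 +
        2 * (finMean p G - c) * (p b * (G b - finMean p G)) + p b * (finMean p G - c) ^ 2 :=
      fun b => by ring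
    simp only [e, Finset.sum_add_distrib, ← Finset.mul_sum, ← Finset.sum_mul,
      sum_mul_sub_finMean hp, hp.2, finVar]
    ring
  rw [h]
  linarith [sq_nonneg (finMean p G - c)]

theorem abs_finVar_sub_le {p : Y → ℝ} (hp : p ∈ stdSimplex ℝ Y) {G H : Y → ℝ} {A η : ℝ}
    (hG : ∀ b, |G b| ≤ A) (hH : ∀ b, |H b| ≤ A) (hη : ∀ b, |G b - H b| ≤ η) :
    |finVar p G - finVar p H| ≤ 8 * A * η := by
  have hmG := abs_finMean_le hp hG
  have hmH := abs_finMean_le hp hH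
  have hm : |finMean p G - finMean p H| ≤ η := by
    have := abs_finMean_le hp hη
    simpa [finMean, mul_sub] using this
  have hterm : ∀ b, |(G b - finMean p G) ^ 2 - (H b - finMean p H) ^ 2| ≤ 8 * A * η := fun b => by
    have e : (G b - finMean p G) ^ 2 - (H b - finMean p H) ^ 2 =
        ((G b + H b) - (finMean p G + finMean p H)) *
          ((G b - H b) - (finMean p G - finMean p H)) := by ring
    rw [e, abs_mul]
    have h1 : |(G b + H b) - (finMean p G + finMean p H)| ≤ 4 * A := by
      have a1 := abs_le.1 (hG b)
      have a2 := abs_le.1 (hH b)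
      have a3 := abs_le.1 hmG
      have a4 := abs_le.1 hmH
      exact abs_le.2 ⟨by linarith, by linarith⟩
    have h2 : |(G b - H b) - (finMean p G - finMean p H)| ≤ 2 * η :=
      (abs_sub _ _).trans (by linarith [hη b])
    calc _ ≤ 4 * A * (2 * η) := mul_le_mul h1 h2 (abs_nonneg _) ((abs_nonneg _).trans h1)
      _ = _ := by ring
  have := abs_finMean_le hp hterm
  simpa [finMean, finVar, mul_sub] using this

end Variance

/-! ### The mixed output distribution and the slack in the dispersion -/

section Channel

variable {X Y : Type*} [Fintype X] [Fintype Y] {W : X → Y → ℝ} {w : Y → ℝ}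

/-- Recentring every conditional variance at the mean under `q` only increases it; the average is
then an expectation under the output of `P`, which is at most `2 * q`. -/
theorem sum_finVar_le (hW : IsChannel W) {P : X → ℝ} (hP : P ∈ stdSimplex ℝ X) {q : Y → ℝ}
    (hq : ∀ y, outputDist W P y ≤ 2 * q y) (G : Y → ℝ) :
    ∑ x, P x * finVar (W x) G ≤ 2 * finVar q G := by
  calc ∑ x, P x * finVar (W x) G
      ≤ ∑ x, P x * finMean (W x) (fun b => (G b - finMean q G) ^ 2) :=
        Finset.sum_le_sum fun x _ =>
          mul_le_mul_of_nonneg_left (finVar_le (hW x) G _) (hP.1 x)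
    _ = finMean (outputDist W P) (fun b => (G b - finMean q G) ^ 2) := sum_mul_finMean _ _ _
    _ ≤ ∑ b, 2 * (q b * (G b - finMean q G) ^ 2) := by
        refine Finset.sum_le_sum fun b _ => ?_
        rw [← mul_assoc]
        exact mul_le_mul_of_nonneg_right (hq b) (sq_nonneg _)
    _ = 2 * finVar q G := by rw [← Finset.mul_sum, finVar]

theorem IsColumnWeight.dispersion_eq (hw : IsColumnWeight W w) (P : X → ℝ) :
    dispersion W P = ∑ x, P x * finVar (W x) (infoDensity w (outputDist W P)) := by
  refine Finset.sum_congr rfl fun x _ => ?_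
  rw [hw.finMean_log, finVar, Finset.mul_sum]
  refine Finset.sum_congr rfl fun y _ => ?_
  rcases hw.1 x y with h | h
  · simp [h]
  · rw [← mul_assoc, infoDensity, h]

/-- The information density relative to the mean of the output distribution of `P` and of `r`. -/
noncomputable def mixDensity (W : X → Y → ℝ) (w r : Y → ℝ) (P : X → ℝ) : Y → ℝ :=
  infoDensity w fun y => (outputDist W P y + r y) / 2

/-- A bound for the information densities relative to distributions between `r / 2` and `1`. -/
noncomputable def densityBound (w r : Y → ℝ) : ℝ :=
  ∑ y, (|Real.log (w y)| + |Real.log (r y / 2)|) + 1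

theorem densityBound_pos {Y : Type*} [Fintype Y] (w r : Y → ℝ) : 0 < densityBound w r := by
  unfold densityBound; positivity

theorem abs_infoDensity_le (hw0 : ∀ y, 0 ≤ w y) {q r : Y → ℝ} (hr : ∀ y, 0 < w y → 0 < r y)
    (hrq : ∀ y, r y / 2 ≤ q y) (hq1 : ∀ y, q y ≤ 1) (y : Y) :
    |infoDensity w q y| ≤ densityBound w r := by
  rcases (hw0 y).eq_or_lt with h | h
  · rw [infoDensity, ← h, zero_div, Real.log_zero, abs_zero]
    exact (densityBound_pos w r).le
  · have hr0 := hr y h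
    have hq0 : 0 < q y := by linarith [hrq y]
    have h1 : |Real.log (q y)| ≤ |Real.log (r y / 2)| := by
      have h2 := Real.log_nonpos hq0.le (hq1 y)
      have h3 := Real.log_le_log (by positivity) (hrq y)
      rw [abs_of_nonpos h2, abs_of_nonpos (h3.trans h2)]
      linarith
    have h4 : |Real.log (w y)| + |Real.log (r y / 2)| ≤
        ∑ y, (|Real.log (w y)| + |Real.log (r y / 2)|) :=
      Finset.single_le_sum (f := fun y => |Real.log (w y)| + |Real.log (r y / 2)|)
        (fun y _ => by positivity) (Finset.mem_univ y)
    rw [infoDensity, Real.log_div h.ne' hq0.ne', densityBound]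
    linarith [abs_sub (Real.log (w y)) (Real.log (q y))]

theorem abs_infoDensity_sub_le (hw0 : ∀ y, 0 ≤ w y) {Q r : Y → ℝ} (hr0 : ∀ y, 0 ≤ r y)
    (hr : ∀ y, 0 < w y → 0 < r y) (hQ : ∀ y, 0 ≤ Q y) (y : Y) :
    |infoDensity w (fun y => (Q y + r y) / 2) y - infoDensity w r y| ≤
      (∑ y, 1 / r y) * ‖Q - r‖ := by
  rcases (hw0 y).eq_or_lt with h | h
  · rw [infoDensity, infoDensity, ← h, zero_div, zero_div, sub_self, abs_zero]
    exact mul_nonneg (Finset.sum_nonneg fun y _ => one_div_nonneg.2 (hr0 y)) (norm_nonneg _)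
  · have hry := hr y h
    have hq : 0 < (Q y + r y) / 2 := by linarith [hQ y]
    have hd : |Q y - r y| ≤ ‖Q - r‖ := norm_le_pi_norm (Q - r) y
    have h1 : 1 / r y ≤ ∑ y, 1 / r y :=
      Finset.single_le_sum (f := fun y => 1 / r y) (fun y _ => one_div_nonneg.2 (hr0 y))
        (Finset.mem_univ y)
    have h2 : |Q y - r y| / r y ≤ (∑ y, 1 / r y) * ‖Q - r‖ := by
      rw [div_eq_mul_one_div, mul_comm]
      exact mul_le_mul h1 hd (abs_nonneg _) ((one_div_nonneg.2 hry.le).trans h1)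
    refine le_trans ?_ h2
    rw [infoDensity, infoDensity, Real.log_div h.ne' hq.ne', Real.log_div h.ne' hry.ne']
    have e : ∀ {a b c : ℝ}, a - b - (a - c) = c - b := by intros; ring
    rw [e, abs_le]
    have l1 := Real.log_le_sub_one_of_pos (div_pos hq hry)
    have l2 := Real.log_le_sub_one_of_pos (div_pos hry hq)
    rw [Real.log_div hq.ne' hry.ne'] at l1
    rw [Real.log_div hry.ne' hq.ne'] at l2
    constructor
    · have : (Q y + r y) / 2 / r y - 1 ≤ |Q y - r y| / r y := by
        rw [div_sub_one hry.ne']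
        gcongr
        linarith [le_abs_self (Q y - r y), abs_nonneg (Q y - r y)]
      linarith
    · have : r y / ((Q y + r y) / 2) - 1 ≤ |Q y - r y| / r y := by
        rw [div_sub_one hq.ne', div_le_div_iff₀ hq hry]
        have := neg_abs_le (Q y - r y)
        nlinarith [mul_nonneg (abs_nonneg (Q y - r y)) (hQ y), abs_nonneg (Q y - r y)]
      linarith

theorem norm_sq_le_sum {Q r : Y → ℝ} : ‖Q - r‖ ^ 2 ≤ ∑ y, (Q y - r y) ^ 2 := by
  have h0 : 0 ≤ ∑ y, (Q y - r y) ^ 2 := Finset.sum_nonneg fun y _ => sq_nonneg _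
  have : ‖Q - r‖ ≤ Real.sqrt (∑ y, (Q y - r y) ^ 2) := by
    rw [pi_norm_le_iff_of_nonneg (Real.sqrt_nonneg _)]
    intro y
    refine Real.le_sqrt_of_sq_le ?_
    rw [Real.norm_eq_abs, sq_abs, Pi.sub_apply]
    exact Finset.single_le_sum (f := fun y => (Q y - r y) ^ 2) (fun y _ => sq_nonneg _)
      (Finset.mem_univ y)
  calc ‖Q - r‖ ^ 2 ≤ Real.sqrt (∑ y, (Q y - r y) ^ 2) ^ 2 := by gcongr
    _ = _ := Real.sq_sqrt h0

theorem finMean_mixture_le (hw0 : ∀ y, 0 ≤ w y) {Q r : Y → ℝ} (hQ : Q ∈ stdSimplex ℝ Y)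
    (hrs : r ∈ stdSimplex ℝ Y) (hr : ∀ y, 0 < w y → 0 < r y) (hrw : ∀ y, w y = 0 → r y = 0)
    (hQw : ∀ y, w y = 0 → Q y = 0) :
    finMean Q (infoDensity w fun y => (Q y + r y) / 2) ≤
      finMean Q (infoDensity w r) - ‖Q - r‖ ^ 2 / 8 := by
  have hterm : ∀ y, Q y * infoDensity w (fun y => (Q y + r y) / 2) y + (Q y - r y) / 2 +
      (Q y - r y) ^ 2 / 8 ≤ Q y * infoDensity w r y := fun y => by
    rcases (hw0 y).eq_or_lt with h | h
    · simp [hrw y h.symm, hQw y h.symm]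
    · have hry := hr y h
      have hq : 0 < (Q y + r y) / 2 := by linarith [hQ.1 y]
      have hr1 := stdSimplex_le_one hrs y
      have hq1 : (Q y + r y) / 2 ≤ 1 := by linarith [stdSimplex_le_one hQ y]
      have l1 := sub_add_sq_le_mul_log hq hry hq1 hr1
      have l2 := sub_add_sq_le_mul_log hry hq hr1 hq1
      rw [Real.log_div hq.ne' hry.ne'] at l1
      rw [Real.log_div hry.ne' hq.ne'] at l2
      rw [infoDensity, infoDensity, Real.log_div h.ne' hq.ne', Real.log_div h.ne' hry.ne']
      nlinarith [sq_nonneg (Q y - r y)]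
  have hs := Finset.sum_le_sum fun y (_ : y ∈ Finset.univ) => hterm y
  rw [Finset.sum_add_distrib, Finset.sum_add_distrib, ← Finset.sum_div, ← Finset.sum_div,
    Finset.sum_sub_distrib, hQ.2, hrs.2] at hs
  have := norm_sq_le_sum (Q := Q) (r := r)
  simp only [finMean]
  linarith

theorem finMean_self_le (hw0 : ∀ y, 0 ≤ w y) {Q r : Y → ℝ} (hQ : Q ∈ stdSimplex ℝ Y)
    (hrs : r ∈ stdSimplex ℝ Y) (hr : ∀ y, 0 < w y → 0 < r y) (hrw : ∀ y, w y = 0 → r y = 0)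
    (hQw : ∀ y, w y = 0 → Q y = 0) :
    finMean Q (infoDensity w Q) ≤ finMean Q (infoDensity w r) - ‖Q - r‖ ^ 2 / 4 := by
  have hterm : ∀ y, Q y * infoDensity w Q y + (Q y - r y) + (Q y - r y) ^ 2 / 4 ≤
      Q y * infoDensity w r y := fun y => by
    have hr1 := stdSimplex_le_one hrs y
    have hr0 := hrs.1 y
    rcases (hw0 y).eq_or_lt with h | h
    · simp [hrw y h.symm, hQw y h.symm]
    · rcases (hQ.1 y).eq_or_lt with hq | hq
      · rw [← hq]
        nlinarith
      · have hry := hr y h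
        have l1 := sub_add_sq_le_mul_log hq hry (stdSimplex_le_one hQ y) hr1
        rw [Real.log_div hq.ne' hry.ne'] at l1
        rw [infoDensity, infoDensity, Real.log_div h.ne' hq.ne', Real.log_div h.ne' hry.ne']
        nlinarith
  have hs := Finset.sum_le_sum fun y (_ : y ∈ Finset.univ) => hterm y
  rw [Finset.sum_add_distrib, Finset.sum_add_distrib, ← Finset.sum_div,
    Finset.sum_sub_distrib, hQ.2, hrs.2] at hs
  have := norm_sq_le_sum (Q := Q) (r := r)
  simp only [finMean]
  linarith

/-- The capacity-achieving output distribution is unique. -/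
theorem outputDist_eq_of_capacityAchieving (hW : IsChannel W) (hw : IsColumnWeight W w)
    {P P' : X → ℝ} (hP : P ∈ capacityAchieving W) (hP' : P' ∈ capacityAchieving W) :
    outputDist W P = outputDist W P' := by
  have h1 := finMean_self_le hw.nonneg (outputDist_mem hW hP.1) (outputDist_mem hW hP'.1)
    (fun y hy => outputDist_pos hW hw hP' hy) (fun y hy => hw.outputDist_eq_zero hy P')
    (fun y hy => hw.outputDist_eq_zero hy P)
  rw [← hw.mutualInfo_eq, hP.2, ← sum_mul_finMean] at h1
  have h2 : ∑ x, P x * finMean (W x) (infoDensity w (outputDist W P')) ≤ capacity W := by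
    calc _ ≤ ∑ x, P x * capacity W := Finset.sum_le_sum fun x _ =>
          mul_le_mul_of_nonneg_left (finMean_infoDensity_le_capacity hW hw hP' x) (hP.1.1 x)
      _ = capacity W := by rw [← Finset.sum_mul, hP.1.2, one_mul]
  have h3 : ‖outputDist W P - outputDist W P'‖ ^ 2 ≤ 0 := by linarith
  exact sub_eq_zero.1 (norm_eq_zero.1 (pow_eq_zero_iff (two_ne_zero) |>.1
    (le_antisymm h3 (sq_nonneg _))))

/-- The defect of the input letter `x` in the optimality condition for the capacity. -/
noncomputable def capacityGap (W : X → Y → ℝ) (w r : Y → ℝ) (x : X) : ℝ :=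
  capacity W - finMean (W x) (infoDensity w r)

theorem sum_mul_capacityGap {P : X → ℝ} (hP : P ∈ stdSimplex ℝ X) (r : Y → ℝ) :
    ∑ x, P x * capacityGap W w r x =
      capacity W - finMean (outputDist W P) (infoDensity w r) := by
  simp only [capacityGap, mul_sub, Finset.sum_sub_distrib, ← Finset.sum_mul, hP.2, one_mul,
    sum_mul_finMean]

/-- A bound on the dispersions of the capacity-achieving input distributions extends to all input
distributions, up to an error that is linear in the distance from optimality. -/
theorem exists_dispersion_slack (hW : IsChannel W) (hw : IsColumnWeight W w) {P₀ : X → ℝ}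
    (hP₀ : P₀ ∈ capacityAchieving W) {σ V : ℝ} (hσ : |σ| ≤ 1)
    (hV : ∀ P ∈ capacityAchieving W, σ * V ≤ σ * dispersion W P) :
    ∃ L : ℝ, 0 ≤ L ∧ ∀ P ∈ stdSimplex ℝ X,
      σ * V - σ * ∑ x, P x * finVar (W x) (mixDensity W w (outputDist W P₀) P) ≤
        L * (∑ x, P x * capacityGap W w (outputDist W P₀) x +
          ‖outputDist W P - outputDist W P₀‖) := by
  set r := outputDist W P₀ with hr
  have hrs : r ∈ stdSimplex ℝ Y := outputDist_mem hW hP₀.1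
  have hrpos : ∀ y, 0 < w y → 0 < r y := fun y hy => outputDist_pos hW hw hP₀ hy
  have hgap : ∀ x, 0 ≤ capacityGap W w r x := fun x =>
    sub_nonneg.2 (finMean_infoDensity_le_capacity hW hw hP₀ x)
  -- For a distribution `P`, `∑ P x • a x = 0` says that its output is `r` and its average defect is
  -- zero, that is, that `P` achieves capacity. The sign `σ` lets one argument serve both the
  -- minimal and the maximal dispersion.
  let a : X → (Y → ℝ) × ℝ := fun x => (W x - r, capacityGap W w r x)
  let b : X → ℝ := fun x => σ * (finVar (W x) (infoDensity w r) - V)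
  have ha1 : ∀ P : X → ℝ, ∑ x, P x = 1 → (∑ x, P x • a x).1 = outputDist W P - r := fun P hP => by
    funext y
    simp only [a, Prod.fst_sum, Prod.smul_fst, Finset.sum_apply, Pi.smul_apply, Pi.sub_apply,
      smul_eq_mul, mul_sub, Finset.sum_sub_distrib, ← Finset.sum_mul, hP, one_mul, outputDist]
  have ha2 : ∀ P : X → ℝ, (∑ x, P x • a x).2 = ∑ x, P x * capacityGap W w r x := fun P => by
    simp only [a, Prod.snd_sum, Prod.smul_snd, smul_eq_mul]
  have hb : ∀ P : X → ℝ, ∑ x, P x = 1 →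
      ∑ x, P x * b x = σ * ∑ x, P x * finVar (W x) (infoDensity w r) - σ * V := fun P hP => by
    have : ∀ x, P x * b x = σ * (P x * finVar (W x) (infoDensity w r)) - P x * (σ * V) :=
      fun x => by simp only [b]; ring
    simp only [this, Finset.sum_sub_distrib, ← Finset.mul_sum, ← Finset.sum_mul, hP, one_mul]
  have hab : ∀ P : X → ℝ, (∀ x, 0 ≤ P x) → ∑ x, P x • a x = 0 → 0 ≤ ∑ x, P x * b x := by
    intro P hP0 hPa
    rcases (Finset.sum_nonneg fun x (_ : x ∈ Finset.univ) => hP0 x).eq_or_lt with hs | hs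
    · have : ∀ x, P x = 0 := fun x =>
        (Finset.sum_eq_zero_iff_of_nonneg fun x _ => hP0 x).1 hs.symm x (Finset.mem_univ x)
      simp [this]
    · set S := ∑ x, P x with hS
      -- The cone bound asks for all nonnegative solutions; normalising reduces them to
      -- distributions.
      let R : X → ℝ := fun x => S⁻¹ * P x
      have hR : R ∈ stdSimplex ℝ X :=
        ⟨fun x => mul_nonneg (inv_nonneg.2 hs.le) (hP0 x), by
          rw [← Finset.mul_sum, ← hS, inv_mul_cancel₀ hs.ne']⟩
      have hRa : ∑ x, R x • a x = 0 := by
        simp only [R, mul_smul, ← Finset.smul_sum, hPa, smul_zero]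
      have h1 : outputDist W R = r := by
        have := ha1 R hR.2
        rw [hRa] at this
        exact (sub_eq_zero.1 this.symm)
      have h2 : ∑ x, R x * capacityGap W w r x = 0 := by rw [← ha2, hRa]; rfl
      have hRC : R ∈ capacityAchieving W := by
        refine ⟨hR, ?_⟩
        rw [sum_mul_capacityGap hR] at h2
        rw [hw.mutualInfo_eq, h1]
        rw [h1] at h2
        linarith
      have h3 := hV R hRC
      rw [hw.dispersion_eq, h1] at h3
      have h4 : 0 ≤ ∑ x, R x * b x := by rw [hb R hR.2]; linarith
      have h5 : ∑ x, P x * b x = S * ∑ x, R x * b x := by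
        simp only [R, mul_assoc, ← Finset.mul_sum]
        rw [mul_inv_cancel_left₀ hs.ne']
      rw [h5]
      exact mul_nonneg hs.le h4
  obtain ⟨L, hL0, hL⟩ := exists_neg_mul_norm_le_sum a b hab
  set A := densityBound w r with hA
  have hA0 : 0 < A := densityBound_pos w r
  set κ := ∑ y, 1 / r y with hκ
  have hκ0 : 0 ≤ κ := Finset.sum_nonneg fun y _ => one_div_nonneg.2 (hrs.1 y)
  refine ⟨L + 8 * A * κ, by positivity, fun P hP => ?_⟩
  set Q := outputDist W P with hQ
  have hQs : Q ∈ stdSimplex ℝ Y := outputDist_mem hW hP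
  set p := ∑ x, P x * capacityGap W w r x with hp
  have hp0 : 0 ≤ p := Finset.sum_nonneg fun x _ => mul_nonneg (hP.1 x) (hgap x)
  set d := ‖Q - r‖ with hd
  have hd0 : 0 ≤ d := norm_nonneg _
  have h1 := hL P hP.1
  rw [hb P hP.2] at h1
  have hnorm : ‖∑ x, P x • a x‖ ≤ p + d := by
    rw [Prod.norm_def, ha1 P hP.2, ha2, Real.norm_of_nonneg hp0]
    exact max_le (by linarith) (by linarith)
  have hlip : |∑ x, P x * finVar (W x) (infoDensity w r) -
      ∑ x, P x * finVar (W x) (mixDensity W w r P)| ≤ 8 * A * (κ * d) := by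
    rw [← Finset.sum_sub_distrib]
    calc _ ≤ ∑ x, P x * (8 * A * (κ * d)) := by
          refine (Finset.abs_sum_le_sum_abs _ _).trans (Finset.sum_le_sum fun x _ => ?_)
          rw [← mul_sub, abs_mul, abs_of_nonneg (hP.1 x)]
          refine mul_le_mul_of_nonneg_left (abs_finVar_sub_le (hW x) ?_ ?_ ?_) (hP.1 x)
          · exact abs_infoDensity_le hw.nonneg hrpos (fun y => by linarith [hrs.1 y])
              (stdSimplex_le_one hrs)
          · exact abs_infoDensity_le hw.nonneg hrpos (fun y => by linarith [hQs.1 y])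
              (fun y => by linarith [stdSimplex_le_one hrs y, stdSimplex_le_one hQs y])
          · intro y
            rw [abs_sub_comm]
            exact abs_infoDensity_sub_le hw.nonneg hrs.1 hrpos hQs.1 y
      _ = _ := by rw [← Finset.sum_mul, hP.2, one_mul]
  have h2 : |σ * (∑ x, P x * finVar (W x) (infoDensity w r) -
      ∑ x, P x * finVar (W x) (mixDensity W w r P))| ≤ 8 * A * (κ * d) := by
    rw [abs_mul]
    exact (mul_le_of_le_one_left (abs_nonneg _) hσ).trans hlip
  have h3 := (abs_le.1 h2).2
  have h4 : L * ‖∑ x, P x • a x‖ ≤ L * (p + d) := mul_le_mul_of_nonneg_left hnorm hL0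
  have h5 : 0 ≤ 8 * A * κ * p := by positivity
  linarith

end Channel

/-! ### Compositions and optimal codes -/

section Codes

variable {X Y : Type*} [Fintype X] [DecidableEq X]

theorem sum_comp_eq_empiricalDist {n : ℕ} (hn : 1 ≤ n) (x : Fin n → X) (h : X → ℝ) :
    ∑ i, h (x i) = n * ∑ a, empiricalDist x a * h a := by
  have hn0 : (n : ℝ) ≠ 0 := by exact_mod_cast (by omega : n ≠ 0)
  rw [← Finset.sum_fiberwise Finset.univ x (fun i => h (x i)), Finset.mul_sum]
  refine Finset.sum_congr rfl fun a _ => ?_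
  rw [Finset.sum_congr rfl (g := fun _ => h a) fun i hi => by rw [(Finset.mem_filter.1 hi).2],
    Finset.sum_const, nsmul_eq_mul, empiricalDist]
  field_simp

theorem empiricalDist_mem {n : ℕ} (hn : 1 ≤ n) (x : Fin n → X) :
    empiricalDist x ∈ stdSimplex ℝ X := by
  refine ⟨fun a => by unfold empiricalDist; positivity, ?_⟩
  have hn0 : (n : ℝ) ≠ 0 := by exact_mod_cast (by omega : n ≠ 0)
  have := sum_comp_eq_empiricalDist hn x fun _ => 1
  simp only [mul_one, Finset.sum_const, Finset.card_univ, Fintype.card_fin, nsmul_eq_mul] at this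
  exact (mul_left_cancel₀ hn0 (by rw [mul_one]; exact this)).symm

theorem exists_code [Fintype Y] [Nonempty X] {W : X → Y → ℝ} (hW : IsChannel W) (n : ℕ) {ε : ℝ}
    (h0 : 0 < ε) (h1 : ε < 1) :
    0 < maxSizeConstComp W n ε ∧
    ∃ (f : Fin (maxSizeConstComp W n ε) → Fin n → X)
      (φ : (Fin n → Y) → Fin (maxSizeConstComp W n ε)),
      IsConstComposition f ∧ avgError W f φ ≤ ε := by
  obtain ⟨R, hR, hε⟩ := (isGreatest_maxSizeConstComp hW n h0 h1).1
  rw [hR]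
  have hpos : 0 < ⌈Real.exp ((n : ℝ) * R)⌉₊ := Nat.ceil_pos.2 (Real.exp_pos _)
  refine ⟨hpos, ?_⟩
  have hmem : minErrorConstComp W n R ∈ {e : ℝ | ∃ (f : Fin ⌈Real.exp (n * R)⌉₊ → Fin n → X)
      (φ : (Fin n → Y) → Fin ⌈Real.exp (n * R)⌉₊), IsConstComposition f ∧ e = avgError W f φ} := by
    refine Set.Nonempty.csInf_mem
      ⟨_, fun _ _ => Classical.arbitrary X, fun _ => ⟨0, hpos⟩, fun _ _ => rfl, rfl⟩ ?_
    refine (Set.finite_range fun c : (Fin ⌈Real.exp (n * R)⌉₊ → Fin n → X) ×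
      ((Fin n → Y) → Fin ⌈Real.exp (n * R)⌉₊) => avgError W c.1 c.2).subset ?_
    rintro e ⟨f, φ, -, rfl⟩
    exact ⟨(f, φ), rfl⟩
  obtain ⟨f, φ, hf, he⟩ := hmem
  exact ⟨f, φ, hf, he ▸ hε⟩

end Codes

/-! ### Uniformity over compositions and conclusion -/

section Main

variable {X Y : Type*} [Fintype X] [Fintype Y] {W : X → Y → ℝ} {w : Y → ℝ}

/-- The losses `n * p` and `n * d² / 8` absorb the gain `√n * L * (p + d)`: complete the square in
`√n` for the first, using `p ≤ B`, and in `√n * d` for the second. -/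
theorem neg_mul_add_sqrt_le {L p d B n : ℝ} (hn : 0 ≤ n) (hp : 0 ≤ p) (hpB : p ≤ B) :
    -(n * p) - n * (d ^ 2 / 8) + Real.sqrt n * (L * (p + d)) ≤ B * L ^ 2 + 2 * L ^ 2 := by
  set u := Real.sqrt n
  have hu : u ^ 2 = n := Real.sq_sqrt hn
  rw [← hu]
  have h1 : u * L - u ^ 2 ≤ L ^ 2 := by nlinarith [sq_nonneg (u - L), sq_nonneg (u + L)]
  have h2 : p * (u * L - u ^ 2) ≤ B * L ^ 2 :=
    (mul_le_mul_of_nonneg_left h1 hp).trans (mul_le_mul_of_nonneg_right hpB (sq_nonneg L))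
  nlinarith [sq_nonneg (u * d - 4 * L)]

/-- The normal approximation bound, given that the dispersion term degrades at most linearly away
from the capacity-achieving input distributions. -/
theorem exists_log_maxSize_le [DecidableEq X] [Nonempty X] (hW : IsChannel W) (hw : IsColumnWeight W w)
    {P₀ : X → ℝ} (hP₀ : P₀ ∈ capacityAchieving W) {ε V L : ℝ} (h0 : 0 < ε) (h1 : ε < 1)
    (hL : ∀ P ∈ stdSimplex ℝ X,
      Real.sqrt (∑ x, P x * finVar (W x) (mixDensity W w (outputDist W P₀) P)) *
        stdNormalQuantile ε ≤ Real.sqrt V * stdNormalQuantile ε +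
        L * (∑ x, P x * capacityGap W w (outputDist W P₀) x +
          ‖outputDist W P - outputDist W P₀‖)) :
    ∃ K : ℝ, 0 < K ∧ ∀ n : ℕ, 1 ≤ n →
      Real.log (maxSizeConstComp W n ε : ℝ) ≤
        n * capacity W + Real.sqrt (n * V) * stdNormalQuantile ε + K := by
  set r := outputDist W P₀ with hr
  have hrs : r ∈ stdSimplex ℝ Y := outputDist_mem hW hP₀.1
  have hrpos : ∀ y, 0 < w y → 0 < r y := fun y hy => outputDist_pos hW hw hP₀ hy
  have hgap : ∀ x, 0 ≤ capacityGap W w r x := fun x =>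
    sub_nonneg.2 (finMean_infoDensity_le_capacity hW hw hP₀ x)
  set z := stdNormalQuantile ε
  obtain ⟨K, hK⟩ := exists_log_card_le hW h0 h1 (densityBound_pos w r)
  set B := ∑ x, capacityGap W w r x with hB
  have hB0 : 0 ≤ B := Finset.sum_nonneg fun x _ => hgap x
  refine ⟨|K| + (B * L ^ 2 + 2 * L ^ 2) + 1, by positivity, fun n hn => ?_⟩
  obtain ⟨hM, f, φ, hf, herr⟩ := exists_code hW n h0 h1
  set P := empiricalDist (f ⟨0, hM⟩) with hP
  have hPs : P ∈ stdSimplex ℝ X := empiricalDist_mem hn _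
  have hfP : ∀ m, empiricalDist (f m) = P := fun m => hf m _
  set Q := outputDist W P with hQ
  have hQs : Q ∈ stdSimplex ℝ Y := outputDist_mem hW hPs
  -- The `r` half keeps `G` bounded independently of `P`; the `Q` half makes the fluctuations under
  -- `q` comparable with those under the channel.
  let q : Y → ℝ := fun y => (Q y + r y) / 2
  have hqs : q ∈ stdSimplex ℝ Y :=
    ⟨fun y => by have := hQs.1 y; have := hrs.1 y; simp only [q]; linarith, by
      simp only [q, ← Finset.sum_div, Finset.sum_add_distrib, hQs.2, hrs.2]; norm_num⟩
  have hrq : ∀ y, r y / 2 ≤ q y := fun y => by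
    have := hQs.1 y
    simp only [q]; linarith
  set G := mixDensity W w r P with hG
  have hGA : ∀ y, |G y| ≤ densityBound w r :=
    abs_infoDensity_le hw.nonneg hrpos hrq (stdSimplex_le_one hqs)
  have hdom : ∀ x y, W x y ≤ Real.exp (G y) * q y := fun x y => by
    rcases (hw.nonneg y).eq_or_lt with h | h
    · rw [hw.eq_zero h.symm x]
      exact mul_nonneg (Real.exp_pos _).le (hqs.1 y)
    · have hq0 : 0 < q y := by have := hrpos y h; linarith [hrq y]
      have : Real.exp (G y) * q y = w y := by
        change Real.exp (Real.log (w y / q y)) * q y = w y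
        rw [Real.exp_log (div_pos h hq0)]
        field_simp
      rw [this]
      rcases hw.1 x y with h' | h'
      · rw [h']; exact h.le
      · exact h'.le
  set Vh := ∑ x, P x * finVar (W x) G with hVh
  have hmean : ∀ m, ∑ i, finMean (W (f m i)) G = n * finMean Q G := fun m => by
    rw [sum_comp_eq_empiricalDist hn (f m) (fun x => finMean (W x) G), hfP, sum_mul_finMean]
  have hvar : ∀ m, ∑ i, finVar (W (f m i)) G = n * Vh := fun m => by
    rw [sum_comp_eq_empiricalDist hn (f m) (fun x => finVar (W x) G), hfP]
  have hvq : n * Vh ≤ 2 * (n * finVar q G) := by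
    have := sum_finVar_le hW hPs (q := q) (fun y => by
      have := hrs.1 y; simp only [q]; linarith) G
    have := mul_le_mul_of_nonneg_left this (Nat.cast_nonneg (α := ℝ) n)
    linarith
  have hmain := hK n _ f φ q G _ _ hM hqs hGA hdom hmean hvar hvq herr
  have hmu : finMean Q G ≤ finMean Q (infoDensity w r) - ‖Q - r‖ ^ 2 / 8 :=
    finMean_mixture_le hw.nonneg hQs hrs hrpos (fun y hy => hw.outputDist_eq_zero hy P₀)
      (fun y hy => hw.outputDist_eq_zero hy P)
  set p := ∑ x, P x * capacityGap W w r x with hp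
  have hp0 : 0 ≤ p := Finset.sum_nonneg fun x _ => mul_nonneg (hPs.1 x) (hgap x)
  have hpB : p ≤ B := Finset.sum_le_sum fun x _ =>
    mul_le_of_le_one_left (hgap x) (stdSimplex_le_one hPs x)
  have hpe : p = capacity W - finMean Q (infoDensity w r) := sum_mul_capacityGap hPs r
  have hmu' : n * finMean Q G ≤ n * (capacity W - p - ‖Q - r‖ ^ 2 / 8) := by
    gcongr
    linarith
  have hsq := mul_le_mul_of_nonneg_left (hL P hPs) (Real.sqrt_nonneg n)
  have hfin := neg_mul_add_sqrt_le (L := L) (d := ‖Q - r‖) (Nat.cast_nonneg (α := ℝ) n) hp0 hpB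
  rw [Real.sqrt_mul (Nat.cast_nonneg n)] at hmain ⊢
  linarith [le_abs_self K]

theorem sqrt_sub_sqrt_le {a b t : ℝ} (ha : 0 < a) (hb : 0 ≤ b) (ht : 0 ≤ t) (h : a - b ≤ t) :
    Real.sqrt a - Real.sqrt b ≤ t / Real.sqrt a := by
  have ha' := Real.sqrt_pos.2 ha
  rw [le_div_iff₀ ha']
  have h1 := Real.sq_sqrt ha.le
  have h2 := Real.sq_sqrt hb
  have h3 := Real.sqrt_nonneg b
  rcases le_total (Real.sqrt a) (Real.sqrt b) with h4 | h4 <;> nlinarith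

theorem sqrt_sub_sqrt_le' {a b t : ℝ} (ha : 0 < a) (hb : 0 ≤ b) (ht : 0 ≤ t) (h : b - a ≤ t) :
    Real.sqrt b - Real.sqrt a ≤ t / Real.sqrt a := by
  have ha' := Real.sqrt_pos.2 ha
  rw [le_div_iff₀ ha']
  have h1 := Real.sq_sqrt ha.le
  have h2 := Real.sq_sqrt hb
  have h3 := Real.sqrt_nonneg b
  rcases le_total (Real.sqrt a) (Real.sqrt b) with h4 | h4 <;> nlinarith

theorem dispersion_nonneg (hW : IsChannel W) {P : X → ℝ} (hP : P ∈ stdSimplex ℝ X) :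
    0 ≤ dispersion W P :=
  Finset.sum_nonneg fun x _ => Finset.sum_nonneg fun y _ =>
    mul_nonneg (mul_nonneg (hP.1 x) ((hW x).1 y)) (sq_nonneg _)

theorem epsDispersion_le (hW : IsChannel W) {ε : ℝ} (hε : ε < 1 / 2) {P : X → ℝ}
    (hP : P ∈ capacityAchieving W) : epsDispersion W ε ≤ dispersion W P := by
  rw [epsDispersion, if_pos hε]
  exact csInf_le ⟨0, by rintro _ ⟨R, hR, rfl⟩; exact dispersion_nonneg hW hR.1⟩
    (mem_image_of_mem _ hP)

theorem epsDispersion_nonneg_of_lt (hW : IsChannel W) {ε : ℝ} (hε : ε < 1 / 2) :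
    0 ≤ epsDispersion W ε := by
  rw [epsDispersion, if_pos hε]
  exact Real.sInf_nonneg (by rintro _ ⟨R, hR, rfl⟩; exact dispersion_nonneg hW hR.1)

theorem le_epsDispersion (hW : IsChannel W) (hw : IsColumnWeight W w) {ε : ℝ} (hε : 1 / 2 < ε)
    {P : X → ℝ} (hP : P ∈ capacityAchieving W) : dispersion W P ≤ epsDispersion W ε := by
  rw [epsDispersion, if_neg (by linarith)]
  refine le_csSup ⟨∑ x, finVar (W x) (infoDensity w (outputDist W P)), ?_⟩
    (mem_image_of_mem _ hP)
  rintro _ ⟨R, hR, rfl⟩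
  rw [hw.dispersion_eq, outputDist_eq_of_capacityAchieving hW hw hR hP]
  exact Finset.sum_le_sum fun x _ =>
    mul_le_of_le_one_left (finVar_nonneg (hW x) _) (stdSimplex_le_one hR.1 x)

end Main

end NormalApprox

theorem proposition2 {X Y : Type*} [Fintype X] [DecidableEq X] [Fintype Y]
    (W : X → Y → ℝ) (hW : NormalApprox.IsChannel W)
    (hsing : NormalApprox.IsSingularChannel W) (hasym : ¬ NormalApprox.IsSymmetricChannel W) :
    (∀ ε : ℝ, 0 < ε → ε < 1 / 2 →
      ∃ K : ℝ, 0 < K ∧ ∀ n : ℕ, 1 ≤ n →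
        Real.log (NormalApprox.maxSizeConstComp W n ε : ℝ) ≤
          n * NormalApprox.capacity W
            + Real.sqrt (n * NormalApprox.epsDispersion W ε) * NormalApprox.stdNormalQuantile ε
            + K) ∧
    (∀ ε : ℝ, 1 / 2 < ε → ε < 1 → 0 < NormalApprox.epsDispersion W ε →
      ∃ K : ℝ, 0 < K ∧ ∀ n : ℕ, 1 ≤ n →
        Real.log (NormalApprox.maxSizeConstComp W n ε : ℝ) ≤
          n * NormalApprox.capacity W
            + Real.sqrt (n * NormalApprox.epsDispersion W ε) * NormalApprox.stdNormalQuantile ε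
            + K) := by
  open NormalApprox in
  have hX : Nonempty X := by
    by_contra hX
    rw [not_nonempty_iff] at hX
    -- Over an empty input alphabet the trivial partition makes the channel symmetric.
    exact hasym ⟨⊤, fun B _ => ⟨fun x => isEmptyElim x, fun _ _ _ _ => ⟨1, fun x => isEmptyElim x⟩⟩⟩
  obtain ⟨w, hw⟩ := exists_isColumnWeight hW hsing
  obtain ⟨P₀, hP₀⟩ := hw.capacityAchieving_nonempty
  have hpos : ∀ P ∈ stdSimplex ℝ X, 0 ≤ ∑ x, P x * capacityGap W w (outputDist W P₀) x +
      ‖outputDist W P - outputDist W P₀‖ := fun P hP =>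
    add_nonneg (Finset.sum_nonneg fun x _ => mul_nonneg (hP.1 x)
      (sub_nonneg.2 (finMean_infoDensity_le_capacity hW hw hP₀ x))) (norm_nonneg _)
  have hVh : ∀ P ∈ stdSimplex ℝ X,
      0 ≤ ∑ x, P x * finVar (W x) (mixDensity W w (outputDist W P₀) P) := fun P hP =>
    Finset.sum_nonneg fun x _ => mul_nonneg (hP.1 x) (finVar_nonneg (hW x) _)
  constructor
  · intro ε h0 h1
    have hz := stdNormalQuantile_nonpos h0 h1.le
    rcases (epsDispersion_nonneg_of_lt hW h1).eq_or_lt with hV | hV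
    -- With zero dispersion the target term vanishes, and since the quantile is nonpositive the
    -- actual term is at most zero, so no slack is needed.
    · refine exists_log_maxSize_le hW hw hP₀ (L := 0) h0 (by linarith) fun P hP => ?_
      rw [← hV, Real.sqrt_zero, zero_mul, zero_mul, add_zero]
      exact mul_nonpos_of_nonneg_of_nonpos (Real.sqrt_nonneg _) hz
    · obtain ⟨L, hL0, hL⟩ := exists_dispersion_slack hW hw hP₀ (σ := 1)
        (V := epsDispersion W ε) (by simp)
        (fun P hP => by simpa using epsDispersion_le hW h1 hP)
      -- Passing from variances to square roots divides the slack by `√V`, which is possible as `V >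
      -- 0`; multiplying by the nonpositive quantile reverses the inequality, hence the lower bound
      -- on the variance.
      refine exists_log_maxSize_le hW hw hP₀
        (L := L / Real.sqrt (epsDispersion W ε) * -stdNormalQuantile ε) h0 (by linarith)
        fun P hP => ?_
      have h2 := hL P hP
      rw [one_mul, one_mul] at h2
      have h3 := sqrt_sub_sqrt_le hV (hVh P hP) (mul_nonneg hL0 (hpos P hP)) h2
      have h4 := mul_le_mul_of_nonneg_right h3 (neg_nonneg.2 hz)
      rw [mul_div_right_comm] at h4
      linarith
  · intro ε h0 h1 hV
    have hz := stdNormalQuantile_nonneg h0 h1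
    obtain ⟨L, hL0, hL⟩ := exists_dispersion_slack hW hw hP₀ (σ := -1)
      (V := epsDispersion W ε) (by simp)
      (fun P hP => by simpa using le_epsDispersion hW hw h0 hP)
    refine exists_log_maxSize_le hW hw hP₀
      (L := L / Real.sqrt (epsDispersion W ε) * stdNormalQuantile ε) (by linarith) h1
      fun P hP => ?_
    have h2 := hL P hP
    have h3 := sqrt_sub_sqrt_le' hV (hVh P hP) (mul_nonneg hL0 (hpos P hP)) (by linarith)
    have h4 := mul_le_mul_of_nonneg_right h3 hz
    rw [mul_div_right_comm] at h4
    linarith
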